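/- For a positive integer $n$ let $\mathcal{P}_n$ be the set of positive integers coprime to $n$, and let $$Z(n)=\sum_{\substack{i+j+k=n\\ i,j,k\in\mathcal{P}_n}}\frac{1}{ijk}.$$ Let $B_m$ denote the Bernoulli numbers, given by $B_0=1$ and $\sum_{i=0}^{m}\binom{m+1}{i}B_i=0$ for $m\ge 1$. For rational numbers $x,y$ whose denominators are coprime to $N$, write $x\equiv y\pmod N$ if $N$ divides the numerator of $x-y$ in lowest terms. **Theorem 1.** Let $p,q$ be distinct odd primes and let $\alpha,\beta$ be positive integers. Then $$\sum_{\substack{i+j+k=2p^{\alpha}q^{\beta}\\ i,j,k\in\mathcal{P}_{pq}}}\frac{(-1)^i}{ijk}\equiv-\frac12 Z(p^{\alpha}q^{\beta})\equiv(q-2)\Bigl(1-\frac1{q^3}\Bigr)p^{\alpha-1}q^{\beta-1}B_{p-3}\pmod{p^{\alpha}},$$ where all three expressions are rational numbers with denominators coprime to $p$. -/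

import Mathlib

/-- Triples `(i, j, k)` of positive integers with `i + j + k = n`, each of them coprime to `m`. -/
def coprimeTriples (n m : ℕ) : Finset (ℕ × ℕ × ℕ) :=
  (Finset.Icc 1 n ×ˢ Finset.Icc 1 n ×ˢ Finset.Icc 1 n).filter fun t =>
    t.1 + t.2.1 + t.2.2 = n ∧ t.1.Coprime m ∧ t.2.1.Coprime m ∧ t.2.2.Coprime m

/-- `Z(n)`: the sum of `1 / (ijk)` over positive integers `i, j, k` coprime to `n` with
`i + j + k = n`. -/
def harmonicZ (n : ℕ) : ℚ :=
  ∑ t ∈ coprimeTriples n n, 1 / ((t.1 : ℚ) * (t.2.1 : ℚ) * (t.2.2 : ℚ))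

/-- The sum of `(-1)^i / (ijk)` over positive integers `i, j, k` coprime to `m` with
`i + j + k = n`. -/
def alternatingSum (n m : ℕ) : ℚ :=
  ∑ t ∈ coprimeTriples n m, (-1 : ℚ) ^ t.1 / ((t.1 : ℚ) * (t.2.1 : ℚ) * (t.2.2 : ℚ))

/-- Congruence of rational numbers modulo `n`: both denominators are coprime to `n`, and `n`
divides the numerator of the difference in lowest terms. -/
def RatModEq (n : ℕ) (x y : ℚ) : Prop :=
  x.den.Coprime n ∧ y.den.Coprime n ∧ (n : ℤ) ∣ (x - y).num

/-! Work in `ℤ_[p]`, with 1/i replaced by 0 when p ∣ i. Coprimality to q and the sign (-1)^i become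
even weights periodic modulo d, where d is q^β or 2q^β. Let S(n) and S(2n) be the weighted sums of
1/(ijk) over 0 ≤ i, j, k < n with total n and 2n.

Lifting: writing each index as a + nx with x < p and expanding to first order in n gives S(pn) ≡ p
S(n) mod p^(m+1) whenever p^m ∣ n and m > 0 (`dvd_boxSum_prime_mul_sub`). Hence the sum at p^α d is
p^(α-1) S(pd) modulo p^α, and only S(pd) modulo p matters.

Characters: modulo p, 1/i is the value of the inverse Teichmüller character χ, which is odd. For χ
in place of 1/i, S(2n) = -S(n) exactly, so summing with weight i + j + k over all triples with n ∣ i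
+ j + k gives -n S(n). Such complete sums split by the Chinese remainder theorem into a Jacobi sum,
the moment Σ x χ(x)³ and an explicit factor (`mul_boxSum_character`). The identities are exact in a
domain of characteristic 0, so p can be cancelled, and comparison with d = 1 removes the Jacobi sum
and the moment. The factor is q^(β-1) (q-2)(1 - χ(q)³) for Z; the alternating sum has the further
factor (2/3)(2χ(2)³ - 1) ≡ -1/2.

Base case: the sum of 1/(ijk) over i + j + k = p is -2B_{p-3} modulo p, by Faulhaber's formula for
harmonic numbers (`dvd_boxSum_recip_add_bernoulli`). -/

/-- The sum of `h i j k` over `i, j, k < n` with `i + j + k = s`. -/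
def boxSum {R : Type*} [CommRing R] (n s : ℕ) (h : ℕ → ℕ → ℕ → R) : R :=
  ∑ i ∈ Finset.range n, ∑ j ∈ Finset.range n, ∑ k ∈ Finset.range n,
    if i + j + k = s then h i j k else 0

/-! ### Sums over triples in a box -/

section Generic

variable {R : Type*} [CommRing R]

theorem sum_range_reflect_of_zero (n : ℕ) (f : ℕ → R) (h0 : f 0 = 0) (hn : f n = 0) :
    ∑ i ∈ Finset.range n, f i = ∑ i ∈ Finset.range n, f (n - i) := by
  have h1 : ∑ i ∈ Finset.range (n + 1), f (n - i) = ∑ i ∈ Finset.range (n + 1), f i := by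
    simpa using Finset.sum_range_reflect f (n + 1)
  rw [Finset.sum_range_succ, Finset.sum_range_succ] at h1
  simpa [h0, hn] using h1.symm

theorem boxSum_congr {n s : ℕ} {f g : ℕ → ℕ → ℕ → R}
    (h : ∀ i < n, ∀ j < n, ∀ k < n, i + j + k = s → f i j k = g i j k) :
    boxSum n s f = boxSum n s g := by
  refine Finset.sum_congr rfl fun i hi => Finset.sum_congr rfl fun j hj =>
    Finset.sum_congr rfl fun k hk => ?_
  split_ifs with hs
  · exact h i (Finset.mem_range.1 hi) j (Finset.mem_range.1 hj) k (Finset.mem_range.1 hk) hs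
  · rfl

theorem dvd_boxSum {n s : ℕ} {f : ℕ → ℕ → ℕ → R} {a : R}
    (h : ∀ i < n, ∀ j < n, ∀ k < n, i + j + k = s → a ∣ f i j k) : a ∣ boxSum n s f := by
  refine Finset.dvd_sum fun i hi => Finset.dvd_sum fun j hj => Finset.dvd_sum fun k hk => ?_
  split_ifs with hs
  · exact h i (Finset.mem_range.1 hi) j (Finset.mem_range.1 hj) k (Finset.mem_range.1 hk) hs
  · exact dvd_zero _

theorem boxSum_mul (n s : ℕ) (f : ℕ → ℕ → ℕ → R) (c : R) :
    boxSum n s (fun i j k => c * f i j k) = c * boxSum n s f := by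
  simp only [boxSum, Finset.mul_sum, mul_ite, mul_zero]

theorem boxSum_sub (n s : ℕ) (f g : ℕ → ℕ → ℕ → R) :
    boxSum n s (fun i j k => f i j k - g i j k) = boxSum n s f - boxSum n s g := by
  simp only [boxSum, ← Finset.sum_sub_distrib]
  refine Finset.sum_congr rfl fun i _ => Finset.sum_congr rfl fun j _ =>
    Finset.sum_congr rfl fun k _ => ?_
  split_ifs <;> simp

/-- The substitution `i ↦ n - i` in each variable. -/
theorem boxSum_two_mul (n : ℕ) (h : ℕ → ℕ → ℕ → R)
    (h1 : ∀ i j k, i = 0 ∨ i = n → h i j k = 0) (h2 : ∀ i j k, j = 0 ∨ j = n → h i j k = 0)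
    (h3 : ∀ i j k, k = 0 ∨ k = n → h i j k = 0) :
    boxSum n (2 * n) h = boxSum n n fun i j k => h (n - i) (n - j) (n - k) := by
  unfold boxSum
  rw [sum_range_reflect_of_zero]
  · refine Finset.sum_congr rfl fun i hi => ?_
    rw [sum_range_reflect_of_zero]
    · refine Finset.sum_congr rfl fun j hj => ?_
      rw [sum_range_reflect_of_zero]
      · refine Finset.sum_congr rfl fun k hk => ?_
        simp only [Finset.mem_range] at hi hj hk
        exact if_congr (by omega) rfl rfl
      · simp [h3]
      · simp [h3]
    · simp [h2]
    · simp [h2]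
  · simp [h1]
  · simp [h1]

theorem sum_range_mul_eq (n m : ℕ) (f : ℕ → R) :
    ∑ i ∈ Finset.range (m * n), f i =
      ∑ a ∈ Finset.range n, ∑ x ∈ Finset.range m, f (a + n * x) := by
  rw [Finset.sum_comm]
  induction m with
  | zero => simp
  | succ m ih =>
    rw [Finset.sum_range_succ, ← ih, add_mul, one_mul, Finset.sum_range_add]
    congr 1
    refine Finset.sum_congr rfl fun a _ => ?_
    rw [add_comm, mul_comm]

/-- Sums over all `i, j, k < n` with `n ∣ i + j + k`, weighted by `i + j + k`. -/
theorem sum_dvd_weighted (n : ℕ) (h : ℕ → ℕ → ℕ → R) :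
    (∑ i ∈ Finset.range n, ∑ j ∈ Finset.range n, ∑ k ∈ Finset.range n,
      if n ∣ i + j + k then ((i : R) + j + k) * h i j k else 0) =
      n * boxSum n n h + 2 * n * boxSum n (2 * n) h := by
  simp only [boxSum, Finset.mul_sum, ← Finset.sum_add_distrib]
  refine Finset.sum_congr rfl fun i hi => Finset.sum_congr rfl fun j hj =>
    Finset.sum_congr rfl fun k hk => ?_
  simp only [Finset.mem_range] at hi hj hk
  by_cases hd : n ∣ i + j + k
  · obtain ⟨c, hc⟩ := hd
    have hc' : ((i : R) + j + k) = n * c := by exact_mod_cast congrArg (Nat.cast (R := R)) hc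
    have hlt : c < 3 := by
      by_contra hcon
      have : n * 3 ≤ n * c := Nat.mul_le_mul_left n (by omega)
      omega
    rw [if_pos ⟨c, hc⟩, hc', hc]
    interval_cases c
    · have : n ≠ 0 := by omega
      simp [this, this.symm]
    · have : n ≠ 2 * n := by omega
      simp [this]
    · have : n * 2 ≠ n := by omega
      have h' : ¬ 2 * n = n := by omega
      rw [if_neg this, if_pos (mul_comm n 2)]
      push_cast
      ring
  · rw [if_neg hd, if_neg, if_neg]
    · simp
    · intro h'; exact hd ⟨2, by omega⟩
    · intro h'; exact hd ⟨1, by omega⟩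

end Generic

/-! ### Counting triples with a given total -/

section Counting

variable {R : Type*} [CommRing R]

/-- Since N < m, the box imposes no constraint: y ranges over N + 1 - x values and then determines
z. -/
theorem boxSum_fst {m N : ℕ} (hN : N < m) (g : ℕ → R) :
    boxSum m N (fun x _ _ => g x) = ∑ x ∈ Finset.range (N + 1), ((N : R) + 1 - x) * g x := by
  unfold boxSum
  have key : ∀ x, (∑ y ∈ Finset.range m, ∑ z ∈ Finset.range m,
      if x + y + z = N then g x else 0) = if x < N + 1 then ((N : R) + 1 - x) * g x else 0 := by
    intro x
    have h1 : ∀ y ∈ Finset.range m, (∑ z ∈ Finset.range m, if x + y + z = N then g x else 0) =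
        if x + y < N + 1 then g x else 0 := by
      intro y _
      split_ifs with h
      · rw [Finset.sum_eq_single (N - x - y)]
        · rw [if_pos (by omega)]
        · intro z _ hz; rw [if_neg (by omega)]
        · intro hz; simp only [Finset.mem_range] at hz; omega
      · exact Finset.sum_eq_zero fun z _ => if_neg (by omega)
    rw [Finset.sum_congr rfl h1]
    split_ifs with h
    · rw [← Finset.sum_filter, Finset.sum_const]
      have : (Finset.range m).filter (fun y => x + y < N + 1) = Finset.range (N + 1 - x) := by
        ext y; simp only [Finset.mem_filter, Finset.mem_range]; omega
      rw [this, Finset.card_range, nsmul_eq_mul, Nat.cast_sub (by omega)]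
      push_cast; ring
    · exact Finset.sum_eq_zero fun y _ => if_neg (by omega)
  simp only [key]
  rw [← Finset.sum_filter]
  congr 1
  ext x; simp only [Finset.mem_filter, Finset.mem_range]; omega

theorem boxSum_perm_snd (m N : ℕ) (h : ℕ → ℕ → ℕ → R) :
    boxSum m N h = boxSum m N fun i j k => h j i k := by
  unfold boxSum
  rw [Finset.sum_comm]
  refine Finset.sum_congr rfl fun i _ => Finset.sum_congr rfl fun j _ =>
    Finset.sum_congr rfl fun k _ => if_congr (by omega) rfl rfl

theorem boxSum_perm_thd (m N : ℕ) (h : ℕ → ℕ → ℕ → R) :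
    boxSum m N h = boxSum m N fun i j k => h k j i := by
  unfold boxSum
  rw [Finset.sum_comm]
  simp_rw [fun j => Finset.sum_comm (s := Finset.range m) (t := Finset.range m)
    (f := fun i k => if i + j + k = N then h i j k else 0)]
  rw [Finset.sum_comm]
  refine Finset.sum_congr rfl fun i _ => Finset.sum_congr rfl fun j _ =>
    Finset.sum_congr rfl fun k _ => if_congr (by omega) rfl rfl

theorem two_mul_sum_sub (N : ℕ) :
    2 * ∑ x ∈ Finset.range (N + 1), ((N : R) + 1 - x) = (N + 1) * (N + 2) := by
  have : ∀ M : ℕ, 2 * ∑ x ∈ Finset.range M, ((N : R) + 1 - x) = M * (2 * N + 3 - M) := by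
    intro M
    induction M with
    | zero => simp
    | succ M ih => rw [Finset.sum_range_succ, mul_add, ih]; push_cast; ring
  rw [this]; push_cast; ring

theorem six_mul_sum_sub_mul (N : ℕ) :
    6 * ∑ x ∈ Finset.range (N + 1), ((N : R) + 1 - x) * x = N * (N + 1) * (N + 2) := by
  have : ∀ M : ℕ, 6 * ∑ x ∈ Finset.range M, ((N : R) + 1 - x) * x =
      M * (M - 1) * (3 * N + 4 - 2 * M) := by
    intro M
    induction M with
    | zero => simp
    | succ M ih => rw [Finset.sum_range_succ, mul_add, ih]; push_cast; ring
  rw [this]; push_cast; ring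

end Counting

/-- Three nonzero residues modulo 3 with sum zero are all equal. This serves the case p = 3, where 6
is not invertible. -/
theorem ZMod.three_esymm_eq_zero : ∀ x y z : ZMod 3, x ≠ 0 → y ≠ 0 → z ≠ 0 → x + y + z = 0 →
    y * z + x * z + x * y = 0 := by decide

/-! ### Inverses in the p-adic integers -/

section Recip

variable (p : ℕ) [Fact p.Prime]

/-- The inverse of `i` in `ℤ_[p]`, or `0` if `p ∣ i`. -/
noncomputable def recip (i : ℕ) : ℤ_[p] := Ring.inverse (i : ℤ_[p])

variable {p}

theorem natCast_dvd_iff (i : ℕ) : (p : ℤ_[p]) ∣ i ↔ p ∣ i := by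
  have := PadicInt.pow_p_dvd_int_iff (p := p) 1 i
  simpa [Int.natCast_dvd_natCast] using this

theorem isUnit_natCast_padicInt (i : ℕ) : IsUnit (i : ℤ_[p]) ↔ ¬ p ∣ i := by
  rw [← natCast_dvd_iff, ← PadicInt.norm_lt_one_iff_dvd, ← PadicInt.not_isUnit_iff, not_not]

theorem mul_recip {i : ℕ} (h : ¬ p ∣ i) : (i : ℤ_[p]) * recip p i = 1 :=
  Ring.mul_inverse_cancel _ ((isUnit_natCast_padicInt i).2 h)

theorem recip_eq_zero {i : ℕ} (h : p ∣ i) : recip p i = 0 :=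
  Ring.inverse_non_unit _ fun hu => (isUnit_natCast_padicInt i).1 hu h

/-- First order expansion of the inverse of `a + n x`. -/
theorem recip_add_mul {a n : ℕ} (hn : p ∣ n) (ha : ¬ p ∣ a) (x : ℕ) :
    recip p (a + n * x) = recip p a * (1 - n * x * recip p a) +
      (n : ℤ_[p]) ^ 2 * (x ^ 2 * recip p a ^ 2 * recip p (a + n * x)) := by
  have h1 := mul_recip ha
  have hax : ¬ p ∣ a + n * x := fun h => ha ((Nat.dvd_add_left (hn.mul_right x)).1 h)
  have h2 := mul_recip hax
  push_cast at h2
  generalize recip p (a + n * x) = A at *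
  generalize recip p a = B at *
  have h3 : A = B - n * x * A * B := by
    linear_combination B * h2 - A * h1
  have h4 : n * x * A * B = B * (n * x * B) - (n : ℤ_[p]) ^ 2 * (x ^ 2 * B ^ 2 * A) := by
    linear_combination (n * x * B) * h3
  linear_combination h3 - h4

theorem recip_sub {a n : ℕ} (hn : p ∣ n) (ha : a ≤ n) :
    recip p (n - a) = -recip p a + n * recip p a * recip p (n - a) := by
  by_cases h : p ∣ a
  · rw [recip_eq_zero h, recip_eq_zero (Nat.dvd_sub hn h)]; simp
  · have h1 := mul_recip h
    have h' : ¬ p ∣ n - a := fun h' => h ((Nat.dvd_sub_iff_right ha hn).1 h')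
    have h2 := mul_recip h'
    rw [Nat.cast_sub ha] at h2
    linear_combination -(recip p (n - a)) * h1 - recip p a * h2

/-- If `a + b + c` and `N(N+1)(N+2)` are divisible by `p`, then the first order term in the
expansion of a sum of `1 / (ijk)` is divisible by `p`. -/
theorem dvd_sum_mul_recip_add {a b c N : ℕ} (hp2 : Odd p) (ha : ¬ p ∣ a) (hb : ¬ p ∣ b)
    (hc : ¬ p ∣ c) (habc : p ∣ a + b + c) (hN : p ∣ N * (N + 1) * (N + 2)) :
    (p : ℤ_[p]) ∣ (∑ x ∈ Finset.range (N + 1), ((N : ℤ_[p]) + 1 - x) * x) *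
      (recip p a + recip p b + recip p c) := by
  have hp : p.Prime := Fact.out
  -- For p = 3 the factor 1/a + 1/b + 1/c = (bc + ac + ab)/(abc) is divisible by p; otherwise 6 is a
  -- unit and the sum N(N+1)(N+2)/6 is.
  by_cases h3 : p = 3
  · apply Dvd.dvd.mul_left
    have hdvd : p ∣ b * c + a * c + a * b := by
      subst h3
      have := ZMod.three_esymm_eq_zero a b c
      simp only [Ne, ← Nat.cast_mul, ← Nat.cast_add, ZMod.natCast_eq_zero_iff] at this
      exact this ha hb hc habc
    have h2 : recip p a + recip p b + recip p c =
        ((b * c + a * c + a * b : ℕ) : ℤ_[p]) * (recip p a * recip p b * recip p c) := by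
      push_cast
      have e1 := mul_recip ha
      have e2 := mul_recip hb
      have e3 := mul_recip hc
      generalize recip p a = A at *
      generalize recip p b = B at *
      generalize recip p c = C at *
      linear_combination (-A*c*C) * e2 - A * e3 - (B * c * C) * e1 - B * e3 - (C * b * B) * e1
        - C * e2
    rw [h2]
    exact ((natCast_dvd_iff _).2 hdvd).mul_right _
  · apply Dvd.dvd.mul_right
    have h6 : IsUnit (6 : ℤ_[p]) := by
      have : IsUnit ((6 : ℕ) : ℤ_[p]) := by
        rw [isUnit_natCast_padicInt]
        intro h
        have : p ∣ 2 * 3 := h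
        rcases hp.dvd_mul.1 this with h | h
        · rw [Nat.prime_dvd_prime_iff_eq hp Nat.prime_two] at h
          subst h; exact absurd hp2 (by decide)
        · rw [Nat.prime_dvd_prime_iff_eq hp Nat.prime_three] at h
          exact h3 h
      simpa using this
    rw [← h6.dvd_mul_left, six_mul_sum_sub_mul]
    have := (natCast_dvd_iff (p := p) _).2 hN
    push_cast at this
    exact this

end Recip

/-! ### Lifting from n to pn -/

section Lift

variable {p : ℕ} [Fact p.Prime]

/-- Terms of second order carry n², hence p^(2m) with 2m ≥ m + 1. The first-order term carries n
and, by `dvd_sum_mul_recip_add`, one more factor p. Only the constant term, times the number of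
triples (x, y, z), survives. -/
theorem dvd_boxSum_recip_expansion {a b c n m N : ℕ} (hp2 : Odd p) (hn : p ^ m ∣ n) (hm : 0 < m)
    (ha : ¬ p ∣ a) (hb : ¬ p ∣ b) (hc : ¬ p ∣ c) (habc : p ∣ a + b + c) (hNp : N < p)
    (hN : p ∣ N * (N + 1) * (N + 2)) :
    (p : ℤ_[p]) ^ (m + 1) ∣
      boxSum p N (fun x y z => recip p (a + n * x) * recip p (b + n * y) * recip p (c + n * z)) -
      (∑ x ∈ Finset.range (N + 1), ((N : ℤ_[p]) + 1 - x)) *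
        (recip p a * recip p b * recip p c) := by
  have hpn : p ∣ n := (dvd_pow_self p hm.ne').trans hn
  have hpm : (p : ℤ_[p]) ^ m ∣ n := by exact_mod_cast Nat.cast_dvd_cast (α := ℤ_[p]) hn
  have hn2 : (p : ℤ_[p]) ^ (m + 1) ∣ (n : ℤ_[p]) ^ 2 := by
    rw [sq]
    calc (p : ℤ_[p]) ^ (m + 1) ∣ (p : ℤ_[p]) ^ (m + m) := pow_dvd_pow _ (by omega)
      _ = (p : ℤ_[p]) ^ m * p ^ m := pow_add _ _ _
      _ ∣ _ := mul_dvd_mul hpm hpm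
  set A := recip p a with hA
  set B := recip p b with hB
  set C := recip p c with hC
  have hlin : boxSum p N (fun x y z => A * B * C * (1 - n * (x * A + y * B + z * C))) =
      (∑ x ∈ Finset.range (N + 1), ((N : ℤ_[p]) + 1 - x)) * (A * B * C) -
      n * ((∑ x ∈ Finset.range (N + 1), ((N : ℤ_[p]) + 1 - x) * x) * (A + B + C)) *
        (A * B * C) := by
    have e0 := boxSum_fst hNp (fun _ => (1 : ℤ_[p]))
    have e1 := boxSum_fst hNp (fun x => (x : ℤ_[p]))
    have e2 := (boxSum_perm_snd p N fun x _ _ => (x : ℤ_[p])).symm.trans e1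
    have e3 := (boxSum_perm_thd p N fun x _ _ => (x : ℤ_[p])).symm.trans e1
    simp only [mul_one] at e0
    have : (fun x y z : ℕ => A * B * C * (1 - n * (x * A + y * B + z * C))) =
        fun x y z : ℕ => (((A * B * C * 1 - (n * A * (A * B * C)) * (x : ℤ_[p])) -
          (n * B * (A * B * C)) * (y : ℤ_[p])) - (n * C * (A * B * C)) * (z : ℤ_[p])) := by
      funext x y z; ring
    rw [this]
    simp only [boxSum_sub]
    rw [boxSum_mul _ _ (fun _ _ _ => (1 : ℤ_[p])), boxSum_mul _ _ (fun x _ _ => (x : ℤ_[p])),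
      boxSum_mul _ _ (fun _ y _ => (y : ℤ_[p])), boxSum_mul _ _ (fun _ _ z => (z : ℤ_[p])),
      e0, e1, e2, e3]
    ring
  have hX := dvd_sum_mul_recip_add hp2 ha hb hc habc hN
  have h1 : (p : ℤ_[p]) ^ (m + 1) ∣
      n * ((∑ x ∈ Finset.range (N + 1), ((N : ℤ_[p]) + 1 - x) * x) * (A + B + C)) *
        (A * B * C) := by
    rw [pow_succ]
    exact (mul_dvd_mul hpm hX).mul_right _
  have h2 : (p : ℤ_[p]) ^ (m + 1) ∣
      boxSum p N (fun x y z => recip p (a + n * x) * recip p (b + n * y) * recip p (c + n * z)) -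
      boxSum p N (fun x y z => A * B * C * (1 - n * (x * A + y * B + z * C))) := by
    rw [← boxSum_sub]
    refine dvd_boxSum fun x _ y _ z _ _ => hn2.trans ?_
    have e1 := recip_add_mul hpn ha x
    have e2 := recip_add_mul hpn hb y
    have e3 := recip_add_mul hpn hc z
    rw [← hA] at e1; rw [← hB] at e2; rw [← hC] at e3
    generalize recip p (a + n * x) = U at *
    generalize recip p (b + n * y) = V at *
    generalize recip p (c + n * z) = W at *
    -- The first three terms replace U, V, W in turn by their linear parts; the rest collects the
    -- quadratic and cubic terms of the product of linear parts.
    refine ⟨x ^ 2 * A ^ 2 * U * (V * W) + A * (1 - n * x * A) * (y ^ 2 * B ^ 2 * V) * W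
      + A * (1 - n * x * A) * (B * (1 - n * y * B)) * (z ^ 2 * C ^ 2 * W)
      + A * B * C * (x * A * (y * B) + x * A * (z * C) + y * B * (z * C)
        - n * (x * A * (y * B) * (z * C))), ?_⟩
    linear_combination (V * W) * e1 + A * (1 - n * x * A) * W * e2
      + A * (1 - n * x * A) * (B * (1 - n * y * B)) * e3
  rw [hlin] at h2
  have := dvd_sub h2 h1
  convert this using 1
  ring

/-- The sums over `i + j + k = 2n` and over `i + j + k = n` are opposite, up to a multiple
of `n`. -/
theorem dvd_boxSum_two_mul_add {n d : ℕ} (hn : p ∣ n) (hd : d ∣ n)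
    (u₁ u₂ u₃ : ZMod d → ℤ_[p]) (h₁ : ∀ x, u₁ (-x) = u₁ x) (h₂ : ∀ x, u₂ (-x) = u₂ x)
    (h₃ : ∀ x, u₃ (-x) = u₃ x) :
    (n : ℤ_[p]) ∣
      boxSum n (2 * n) (fun i j k => u₁ i * recip p i * (u₂ j * recip p j) * (u₃ k * recip p k)) +
      boxSum n n (fun i j k => u₁ i * recip p i * (u₂ j * recip p j) * (u₃ k * recip p k)) := by
  have hz : ∀ i, i = 0 ∨ i = n → recip p i = 0 := by
    rintro i (rfl | rfl)
    · exact recip_eq_zero (dvd_zero _)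
    · exact recip_eq_zero hn
  have hu : ∀ u : ZMod d → ℤ_[p], (∀ x, u (-x) = u x) → ∀ i ≤ n,
      u ((n - i : ℕ) : ZMod d) = u i := by
    intro u h i hi
    rw [Nat.cast_sub hi, (ZMod.natCast_eq_zero_iff n d).2 hd, zero_sub, h]
  rw [boxSum_two_mul]
  · rw [← neg_neg (boxSum n n (fun i j k => u₁ i * recip p i * (u₂ j * recip p j) *
      (u₃ k * recip p k))), ← sub_eq_add_neg, ← neg_one_mul (boxSum n n _), ← boxSum_mul,
      ← boxSum_sub]
    refine dvd_boxSum fun i hi j hj k hk _ => ?_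
    rw [hu u₁ h₁ i hi.le, hu u₂ h₂ j hj.le, hu u₃ h₃ k hk.le]
    have e1 := recip_sub hn hi.le
    have e2 := recip_sub hn hj.le
    have e3 := recip_sub hn hk.le
    generalize recip p (n - i) = U at *
    generalize recip p (n - j) = V at *
    generalize recip p (n - k) = W at *
    -- Replace 1/(n-i), 1/(n-j), 1/(n-k) by -1/i, -1/j, -1/k one at a time; three sign changes give
    -- the opposite term.
    refine ⟨u₁ i * u₂ j * u₃ k * (recip p i * U * (V * W) - recip p i * (recip p j * V) * W
      + recip p i * recip p j * (recip p k * W)), ?_⟩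
    linear_combination u₁ i * u₂ j * u₃ k * ((V * W) * e1 - recip p i * W * e2
      + recip p i * recip p j * e3)
  · intro i j k h; rw [hz i h]; ring
  · intro i j k h; rw [hz j h]; ring
  · intro i j k h; rw [hz k h]; ring

/-- Passing from `n` to `pn` multiplies the sum by `p`, with one more digit of precision. -/
theorem dvd_boxSum_prime_mul_sub {n d m : ℕ} (hp2 : Odd p) (hn : p ^ m ∣ n) (hm : 0 < m)
    (hd : d ∣ n) (u₁ u₂ u₃ : ZMod d → ℤ_[p]) (h₁ : ∀ x, u₁ (-x) = u₁ x)
    (h₂ : ∀ x, u₂ (-x) = u₂ x) (h₃ : ∀ x, u₃ (-x) = u₃ x) :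
    (p : ℤ_[p]) ^ (m + 1) ∣
      boxSum (p * n) (p * n)
        (fun i j k => u₁ i * recip p i * (u₂ j * recip p j) * (u₃ k * recip p k)) -
      p * boxSum n n
        (fun i j k => u₁ i * recip p i * (u₂ j * recip p j) * (u₃ k * recip p k)) := by
  have hp : p.Prime := Fact.out
  have hpn : p ∣ n := (dvd_pow_self p hm.ne').trans hn
  obtain ⟨h, hh⟩ := hp2
  set F : ℕ → ℕ → ℕ → ℤ_[p] :=
    fun i j k => u₁ i * recip p i * (u₂ j * recip p j) * (u₃ k * recip p k) with hF
  have hT : (p : ℤ_[p]) ^ (m + 1) ∣ p * (boxSum n (2 * n) F + boxSum n n F) := by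
    rw [pow_succ, mul_comm]
    refine mul_dvd_mul_left _ (dvd_trans ?_
      (dvd_boxSum_two_mul_add hpn hd u₁ u₂ u₃ h₁ h₂ h₃))
    exact_mod_cast Nat.cast_dvd_cast (α := ℤ_[p]) hn
  have hC : ∀ N C : ℕ, 2 * C = (N + 1) * (N + 2) →
      ∑ x ∈ Finset.range (N + 1), ((N : ℤ_[p]) + 1 - x) = C := by
    intro N C hNC
    have e1 := two_mul_sum_sub (R := ℤ_[p]) N
    have e2 : (2 : ℤ_[p]) * C = (N + 1) * (N + 2) := by exact_mod_cast hNC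
    exact mul_left_cancel₀ (two_ne_zero) (e1.trans e2.symm)
  -- With p = 2h + 1, residues a + b + c = n leave x + y + z = p - 1, with p(h+1) solutions, and a +
  -- b + c = 2n leave x + y + z = p - 2, with ph solutions.
  have key : (p : ℤ_[p]) ^ (m + 1) ∣ boxSum (p * n) (p * n) F -
      (p * (h + 1) * boxSum n n F + p * h * boxSum n (2 * n) F) := by
    have hsplit : boxSum (p * n) (p * n) F =
        ∑ a ∈ Finset.range n, ∑ b ∈ Finset.range n, ∑ c ∈ Finset.range n,
          ∑ x ∈ Finset.range p, ∑ y ∈ Finset.range p, ∑ z ∈ Finset.range p,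
            if (a + n * x) + (b + n * y) + (c + n * z) = p * n then
              F (a + n * x) (b + n * y) (c + n * z) else 0 := by
      unfold boxSum
      simp only [sum_range_mul_eq]
      refine Finset.sum_congr rfl fun a _ => ?_
      rw [Finset.sum_comm]
      refine Finset.sum_congr rfl fun b _ => ?_
      simp_rw [fun x => Finset.sum_comm (s := Finset.range p) (t := Finset.range n)
        (f := fun y c => ∑ z ∈ Finset.range p,
          if (a + n * x) + (b + n * y) + (c + n * z) = p * n then
              F (a + n * x) (b + n * y) (c + n * z) else 0)]
      rw [Finset.sum_comm]
    rw [hsplit, ← boxSum_mul, ← boxSum_mul]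
    unfold boxSum
    simp only [← Finset.sum_sub_distrib, ← Finset.sum_add_distrib]
    refine Finset.dvd_sum fun a ha => Finset.dvd_sum fun b hb => Finset.dvd_sum fun c hc => ?_
    simp only [Finset.mem_range] at ha hb hc
    have hcast : ∀ i x : ℕ, ((i + n * x : ℕ) : ZMod d) = i := by
      intro i x
      rw [Nat.cast_add, Nat.cast_mul, (ZMod.natCast_eq_zero_iff n d).2 hd, zero_mul, add_zero]
    have hdvd : ∀ i x : ℕ, p ∣ i → p ∣ i + n * x := fun i x hi => dvd_add hi (hpn.mul_right x)
    by_cases hz : p ∣ a ∨ p ∣ b ∨ p ∣ c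
    · have hF0 : F a b c = 0 := by
        rcases hz with hz | hz | hz <;> simp [hF, recip_eq_zero hz]
      have hF1 : ∀ x y z, F (a + n * x) (b + n * y) (c + n * z) = 0 := by
        intro x y z
        rcases hz with hz | hz | hz <;> simp [hF, recip_eq_zero (hdvd _ _ hz)]
      simp [hF0, hF1]
    push Not at hz
    obtain ⟨pa, pb, pc⟩ := hz
    have ha0 : a ≠ 0 := by rintro rfl; exact pa (dvd_zero _)
    have hinner : ∀ s N C : ℕ, a + b + c = s * n → s + N = p → 2 * C = (N + 1) * (N + 2) → 0 < s →
        p ∣ N * (N + 1) * (N + 2) → (p : ℤ_[p]) ^ (m + 1) ∣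
        (∑ x ∈ Finset.range p, ∑ y ∈ Finset.range p, ∑ z ∈ Finset.range p,
            if (a + n * x) + (b + n * y) + (c + n * z) = p * n then
              F (a + n * x) (b + n * y) (c + n * z) else 0) - C * F a b c := by
      intro s N C hs hsN hNC hs0 hN
      have h0 := dvd_boxSum_recip_expansion (n := n) ⟨h, hh⟩ hn hm pa pb pc
        (hs ▸ hpn.mul_left s) (by omega) hN
      rw [hC N C hNC] at h0
      have h1 := h0.mul_left (u₁ a * u₂ b * u₃ c)
      convert h1 using 1
      rw [mul_sub, ← boxSum_mul]
      congr 1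
      · unfold boxSum
        refine Finset.sum_congr rfl fun x _ => Finset.sum_congr rfl fun y _ =>
          Finset.sum_congr rfl fun z _ => if_congr ?_ ?_ rfl
        · have : a + n * x + (b + n * y) + (c + n * z) = n * (s + (x + y + z)) := by
            linear_combination hs
          rw [this, mul_comm p n, Nat.mul_right_inj (by omega)]
          omega
        · simp only [hF, hcast]; ring
      · simp only [hF]; ring
    by_cases e1 : a + b + c = n
    · have e2 : a + b + c ≠ 2 * n := by omega
      rw [if_pos e1, if_neg e2, add_zero]
      have := hinner 1 (p - 1) (p * (h + 1)) (by omega) (by omega)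
        (by rw [hh, Nat.add_sub_cancel]; ring) one_pos
        (by rw [Nat.sub_add_cancel hp.one_le]; exact ⟨(p - 1) * (p - 1 + 2), by ring⟩)
      push_cast at this
      exact this
    · rw [if_neg e1, zero_add]
      by_cases e2 : a + b + c = 2 * n
      · rw [if_pos e2]
        have h2 : 2 ≤ p := hp.two_le
        have := hinner 2 (p - 2) (p * h) (by omega) (by omega)
          (by rw [show p - 2 + 2 = p by omega, show p - 2 + 1 = 2 * h by omega]; ring) two_pos
          (by rw [show p - 2 + 2 = p by omega]; exact Dvd.intro_left _ rfl)
        push_cast at this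
        exact this
      · rw [if_neg e2, sub_zero]
        convert dvd_zero _
        refine Finset.sum_eq_zero fun x _ => Finset.sum_eq_zero fun y _ =>
          Finset.sum_eq_zero fun z _ => if_neg fun hsum => ?_
        have hdn : n ∣ a + b + c := by
          have h4 : n ∣ (a + b + c) + n * (x + y + z) := ⟨p, by linear_combination hsum⟩
          exact (Nat.dvd_add_left (Dvd.intro _ rfl)).1 h4
        obtain ⟨t, ht⟩ := hdn
        have : t < 3 := by
          by_contra hcon
          have : n * 3 ≤ n * t := Nat.mul_le_mul_left n (by omega)
          omega
        interval_cases t <;> omega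
  -- S(2n) ≡ -S(n) modulo n turns p(h+1) S(n) + ph S(2n) into p S(n).
  have := dvd_add key (hT.mul_left (h : ℤ_[p]))
  convert this using 1
  ring

theorem dvd_boxSum_prime_pow_sub {d : ℕ} (hp2 : Odd p) (u₁ u₂ u₃ : ZMod d → ℤ_[p])
    (h₁ : ∀ x, u₁ (-x) = u₁ x) (h₂ : ∀ x, u₂ (-x) = u₂ x) (h₃ : ∀ x, u₃ (-x) = u₃ x) (m : ℕ) :
    (p : ℤ_[p]) ^ (m + 1) ∣
      boxSum (p ^ (m + 1) * d) (p ^ (m + 1) * d)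
        (fun i j k => u₁ i * recip p i * (u₂ j * recip p j) * (u₃ k * recip p k)) -
      p ^ m * boxSum (p * d) (p * d)
        (fun i j k => u₁ i * recip p i * (u₂ j * recip p j) * (u₃ k * recip p k)) := by
  induction m with
  | zero => simp
  | succ m ih =>
    have h := dvd_boxSum_prime_mul_sub hp2 (Dvd.intro _ rfl) m.succ_pos (Dvd.intro_left _ rfl)
      u₁ u₂ u₃ h₁ h₂ h₃ (n := p ^ (m + 1) * d)
    have h' := mul_dvd_mul_left (p : ℤ_[p]) ih
    rw [← pow_succ'] at h'
    rw [show p ^ (m + 1 + 1) * d = p * (p ^ (m + 1) * d) by ring]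
    convert dvd_add h h' using 1
    ring

end Lift

/-! ### The Teichmüller character and complete character sums -/

section Character

variable {p : ℕ} [Fact p.Prime]

theorem sum_range_natCast_zmod {R : Type*} [AddCommMonoid R] (n : ℕ) [NeZero n]
    (g : ZMod n → R) : ∑ i ∈ Finset.range n, g i = ∑ x, g x := by
  refine Finset.sum_nbij' (fun i => (i : ZMod n)) ZMod.val (fun _ _ => Finset.mem_univ _)
    (fun x _ => Finset.mem_range.2 (ZMod.val_lt x)) ?_ ?_ ?_
  · intro i hi; exact ZMod.val_cast_of_lt (Finset.mem_range.1 hi)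
  · intro x _; exact ZMod.natCast_zmod_val x
  · intro i _; rfl

theorem sum_range_natCast_prod {R : Type*} [AddCommMonoid R] {m d : ℕ} [NeZero m] [NeZero d]
    (h : m.Coprime d) (g : ZMod m × ZMod d → R) :
    ∑ i ∈ Finset.range (m * d), g ((i : ZMod m), (i : ZMod d)) = ∑ x, g x := by
  have e := sum_range_natCast_zmod (m * d) fun x => g (ZMod.chineseRemainder h x)
  refine Eq.trans ?_ (e.trans (Equiv.sum_comp (ZMod.chineseRemainder h).toEquiv g))
  refine Finset.sum_congr rfl fun i _ => ?_
  rw [map_natCast]; rfl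

theorem toZMod_equiv_teichmuller (x : ZMod p) :
    PadicInt.toZMod (WittVector.equiv p (WittVector.teichmuller p x)) = x := by
  set f : ℤ_[p] →+* ZMod p :=
    (WittVector.constantCoeff : WittVector p (ZMod p) →+* ZMod p).comp
      (WittVector.equiv p).symm.toRingHom with hf
  -- A ring homomorphism to `ZMod p` kills p, so it is determined by its values on natural numbers
  -- and must be the reduction map.
  have hfz : ∀ z : ℤ_[p], f z = PadicInt.toZMod z := by
    intro z
    obtain ⟨n, -, hn⟩ := PadicInt.exists_mem_range (p := p) z
    rw [PadicInt.maximalIdeal_eq_span_p, Ideal.mem_span_singleton] at hn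
    obtain ⟨w, hw⟩ := hn
    have hz : z = n + p * w := by rw [← hw]; ring
    rw [hz]
    simp
  rw [← hfz]
  simp [hf, WittVector.constantCoeff_apply]

/-- The inverse of the Teichmüller character. -/
noncomputable def teichmullerInv (p : ℕ) [Fact p.Prime] : ZMod p →*₀ ℤ_[p] where
  toFun x := WittVector.equiv p (WittVector.teichmuller p x⁻¹)
  map_zero' := by simp
  map_one' := by simp
  map_mul' x y := by simp [mul_comm]

theorem toZMod_teichmullerInv (x : ZMod p) : PadicInt.toZMod (teichmullerInv p x) = x⁻¹ :=
  toZMod_equiv_teichmuller _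

theorem dvd_iff_toZMod_eq_zero (z : ℤ_[p]) : (p : ℤ_[p]) ∣ z ↔ PadicInt.toZMod z = 0 := by
  rw [← RingHom.mem_ker, PadicInt.ker_toZMod, PadicInt.maximalIdeal_eq_span_p,
    Ideal.mem_span_singleton]

theorem toZMod_recip (i : ℕ) : PadicInt.toZMod (recip p i) = (i : ZMod p)⁻¹ := by
  by_cases h : p ∣ i
  · rw [recip_eq_zero h, (ZMod.natCast_eq_zero_iff i p).2 h]; simp
  · refine eq_inv_of_mul_eq_one_right ?_
    have := congrArg PadicInt.toZMod (mul_recip h)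
    simpa using this

theorem teichmullerInv_neg (hp2 : Odd p) (x : ZMod p) :
    teichmullerInv p (-x) = -teichmullerInv p x := by
  have h1 : teichmullerInv p (-1) = -1 := by
    -- The value at -1 is a square root of 1, and reduction modulo the odd prime p excludes 1.
    have hsq : teichmullerInv p (-1) * teichmullerInv p (-1) = 1 := by
      rw [← map_mul]; simp
    rcases mul_self_eq_one_iff.1 hsq with h | h
    · exfalso
      have h2 := toZMod_teichmullerInv (p := p) (-1)
      rw [h, map_one, inv_neg, inv_one] at h2
      have : Fact (2 < p) := ⟨lt_of_le_of_ne (Fact.out : p.Prime).two_le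
        (by rintro rfl; exact absurd hp2 (by decide))⟩
      exact ZMod.neg_one_ne_one h2.symm
    · exact h
  rw [← neg_one_mul, map_mul, h1, neg_one_mul]

theorem dvd_boxSum_teichmullerInv_sub_recip {n s d : ℕ} (u₁ u₂ u₃ : ZMod d → ℤ_[p]) :
    (p : ℤ_[p]) ∣
      boxSum n s (fun i j k => u₁ i * recip p i * (u₂ j * recip p j) * (u₃ k * recip p k)) -
      boxSum n s (fun i j k => u₁ i * teichmullerInv p i * (u₂ j * teichmullerInv p j) *
        (u₃ k * teichmullerInv p k)) := by
  rw [← boxSum_sub]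
  refine dvd_boxSum fun i _ j _ k _ _ => ?_
  rw [dvd_iff_toZMod_eq_zero]
  simp only [map_sub, map_mul, toZMod_recip, toZMod_teichmullerInv, sub_self]

/-- Additive convolution on `ZMod d`. -/
noncomputable def addConv {d : ℕ} [NeZero d] (u v : ZMod d → ℤ_[p]) (l : ZMod d) : ℤ_[p] :=
  ∑ y, u y * v (l - y)

/-- The Jacobi sum of a character with itself. -/
noncomputable def selfJacobi (χ : ZMod p →*₀ ℤ_[p]) : ℤ_[p] := ∑ x, χ x * χ (1 - x)

theorem sum_mul_sub_eq (χ : ZMod p →*₀ ℤ_[p]) {l : ZMod p} (hl : l ≠ 0) :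
    ∑ x, χ x * χ (l - x) = χ l ^ 2 * selfJacobi χ := by
  rw [selfJacobi, Finset.mul_sum, ← Equiv.sum_comp (Equiv.mulLeft₀ l hl)]
  refine Finset.sum_congr rfl fun x _ => ?_
  rw [show Equiv.mulLeft₀ l hl x = l * x from rfl, show l - l * x = l * (1 - x) by ring,
    map_mul, map_mul]
  ring

/-- The divisibility determines k modulo p and modulo d. The sum over j then splits by the Chinese
remainder theorem into a convolution of χ, equal to χ(i)² times the Jacobi sum, and a convolution of
weights modulo d. -/
theorem sum_dvd_mul_first {d : ℕ} [NeZero d] (hd : p.Coprime d) (χ : ZMod p →*₀ ℤ_[p])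
    (hχ : ∀ x, χ (-x) = -χ x) (u₁ u₂ u₃ : ZMod d → ℤ_[p]) :
    (∑ i ∈ Finset.range (p * d), ∑ j ∈ Finset.range (p * d), ∑ k ∈ Finset.range (p * d),
      if p * d ∣ i + j + k then (i : ℤ_[p]) * (u₁ i * χ i * (u₂ j * χ j) * (u₃ k * χ k)) else 0) =
    selfJacobi χ * ∑ i ∈ Finset.range (p * d),
      (i : ℤ_[p]) * χ i ^ 3 * (u₁ i * addConv u₂ u₃ (-i)) := by
  rw [Finset.mul_sum]
  refine Finset.sum_congr rfl fun i _ => ?_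
  have hcond : ∀ j k : ℕ, p * d ∣ i + j + k ↔
      ((k : ZMod p), (k : ZMod d)) = (-(i : ZMod p) - j, -(i : ZMod d) - j) := by
    intro j k
    have hiff : ∀ m : ℕ, m ∣ i + j + k ↔ (k : ZMod m) = -(i : ZMod m) - j := by
      intro m
      rw [← ZMod.natCast_eq_zero_iff]
      push_cast
      constructor <;> intro h <;> linear_combination h
    rw [Prod.mk.injEq, ← hiff, ← hiff]
    exact ⟨fun h => ⟨dvd_of_mul_right_dvd h, dvd_of_mul_left_dvd h⟩,
      fun h => hd.mul_dvd_of_dvd_of_dvd h.1 h.2⟩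
  have hin : ∀ j : ℕ, (∑ k ∈ Finset.range (p * d), if p * d ∣ i + j + k then
      (i : ℤ_[p]) * (u₁ i * χ i * (u₂ j * χ j) * (u₃ k * χ k)) else 0) =
      (i : ℤ_[p]) * (u₁ i * χ i * (u₂ j * χ j) * (u₃ (-i - j) * χ (-i - j))) := by
    intro j
    simp only [hcond]
    rw [sum_range_natCast_prod hd fun P : ZMod p × ZMod d =>
      if P = (-(i : ZMod p) - j, -(i : ZMod d) - j) then
        (i : ℤ_[p]) * (u₁ i * χ i * (u₂ j * χ j) * (u₃ P.2 * χ P.1)) else 0]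
    rw [Finset.sum_ite_eq' Finset.univ]
    simp
  simp only [hin]
  rw [sum_range_natCast_prod hd fun P : ZMod p × ZMod d =>
    (i : ℤ_[p]) * (u₁ i * χ i * (u₂ P.2 * χ P.1) * (u₃ (-i - P.2) * χ (-i - P.1)))]
  by_cases h0 : (i : ZMod p) = 0
  · simp [h0]
  have hJ := sum_mul_sub_eq χ (neg_ne_zero.2 h0)
  rw [hχ, neg_sq] at hJ
  have : (∑ P : ZMod p × ZMod d,
      (i : ℤ_[p]) * (u₁ i * χ i * (u₂ P.2 * χ P.1) * (u₃ (-i - P.2) * χ (-i - P.1)))) =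
      (i : ℤ_[p]) * (u₁ i * χ i) * ((∑ x : ZMod p, χ x * χ (-i - x)) * addConv u₂ u₃ (-i)) := by
    rw [addConv, Finset.sum_mul_sum, Fintype.sum_prod_type, Finset.mul_sum]
    refine Finset.sum_congr rfl fun x _ => ?_
    rw [Finset.mul_sum]
    refine Finset.sum_congr rfl fun y _ => ?_
    ring
  rw [this, hJ]
  ring

/-- By oddness the sum over total 2n is minus the sum over total n, so the sum weighted by i + j + k
equals nS - 2nS = -nS. Splitting the weight into i, j and k and permuting variables reduces each
part to `sum_dvd_mul_first`. -/
theorem mul_boxSum_character {d : ℕ} [NeZero d] (hd : p.Coprime d) (χ : ZMod p →*₀ ℤ_[p])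
    (hχ : ∀ x, χ (-x) = -χ x) (u₁ u₂ u₃ : ZMod d → ℤ_[p])
    (h₁ : ∀ x, u₁ (-x) = u₁ x) (h₂ : ∀ x, u₂ (-x) = u₂ x) (h₃ : ∀ x, u₃ (-x) = u₃ x) :
    (p * d : ℤ_[p]) * boxSum (p * d) (p * d)
      (fun i j k => u₁ i * χ i * (u₂ j * χ j) * (u₃ k * χ k)) =
    -(selfJacobi χ * ∑ i ∈ Finset.range (p * d), (i : ℤ_[p]) * χ i ^ 3 *
      (u₁ i * addConv u₂ u₃ (-i) + u₂ i * addConv u₁ u₃ (-i) + u₃ i * addConv u₂ u₁ (-i))) := by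
  set n := p * d with hn
  have hz : ∀ i, i = 0 ∨ i = n → χ (i : ZMod p) = 0 := by
    rintro i (rfl | rfl) <;> simp [hn]
  have hrefl : boxSum n (2 * n) (fun i j k => u₁ i * χ i * (u₂ j * χ j) * (u₃ k * χ k)) =
      -boxSum n n (fun i j k => u₁ i * χ i * (u₂ j * χ j) * (u₃ k * χ k)) := by
    rw [boxSum_two_mul, ← neg_one_mul, ← boxSum_mul]
    · refine boxSum_congr fun i hi j hj k hk _ => ?_
      have e1 : ∀ i ≤ n, ((n - i : ℕ) : ZMod p) = -i := fun i hi => by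
        rw [Nat.cast_sub hi]; simp [hn]
      have e2 : ∀ i ≤ n, ((n - i : ℕ) : ZMod d) = -i := fun i hi => by
        rw [Nat.cast_sub hi]; simp [hn]
      rw [e1 i hi.le, e1 j hj.le, e1 k hk.le, e2 i hi.le, e2 j hj.le, e2 k hk.le,
        h₁, h₂, h₃, hχ, hχ, hχ]
      ring
    · intro i j k h; rw [hz i h]; ring
    · intro i j k h; rw [hz j h]; ring
    · intro i j k h; rw [hz k h]; ring
  have hw := sum_dvd_weighted n (fun i j k => u₁ i * χ i * (u₂ j * χ j) * (u₃ k * χ k))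
  rw [hrefl] at hw
  have p1 := sum_dvd_mul_first hd χ hχ u₁ u₂ u₃
  have p2 := sum_dvd_mul_first hd χ hχ u₂ u₁ u₃
  have p3 := sum_dvd_mul_first hd χ hχ u₃ u₂ u₁
  rw [← hn] at p1 p2 p3
  have s2 : (∑ i ∈ Finset.range n, ∑ j ∈ Finset.range n, ∑ k ∈ Finset.range n,
      if n ∣ i + j + k then (i : ℤ_[p]) * (u₂ i * χ i * (u₁ j * χ j) * (u₃ k * χ k)) else 0) =
      ∑ i ∈ Finset.range n, ∑ j ∈ Finset.range n, ∑ k ∈ Finset.range n,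
      if n ∣ i + j + k then (j : ℤ_[p]) * (u₁ i * χ i * (u₂ j * χ j) * (u₃ k * χ k)) else 0 := by
    rw [Finset.sum_comm]
    refine Finset.sum_congr rfl fun i _ => Finset.sum_congr rfl fun j _ =>
      Finset.sum_congr rfl fun k _ => if_congr (by rw [add_comm i j]) (by ring) rfl
  have s3 : (∑ i ∈ Finset.range n, ∑ j ∈ Finset.range n, ∑ k ∈ Finset.range n,
      if n ∣ i + j + k then (i : ℤ_[p]) * (u₃ i * χ i * (u₂ j * χ j) * (u₁ k * χ k)) else 0) =
      ∑ i ∈ Finset.range n, ∑ j ∈ Finset.range n, ∑ k ∈ Finset.range n,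
      if n ∣ i + j + k then (k : ℤ_[p]) * (u₁ i * χ i * (u₂ j * χ j) * (u₃ k * χ k)) else 0 := by
    rw [Finset.sum_comm]
    simp_rw [fun j => Finset.sum_comm (s := Finset.range n) (t := Finset.range n)
      (f := fun i k => if n ∣ i + j + k then
        (i : ℤ_[p]) * (u₃ i * χ i * (u₂ j * χ j) * (u₁ k * χ k)) else 0)]
    rw [Finset.sum_comm]
    refine Finset.sum_congr rfl fun i _ => Finset.sum_congr rfl fun j _ =>
      Finset.sum_congr rfl fun k _ => if_congr (by
        rw [show k + j + i = i + j + k by ring]) (by ring) rfl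
  rw [s2] at p2
  rw [s3] at p3
  have hsum : (∑ i ∈ Finset.range n, ∑ j ∈ Finset.range n, ∑ k ∈ Finset.range n,
      if n ∣ i + j + k then ((i : ℤ_[p]) + j + k) *
        (u₁ i * χ i * (u₂ j * χ j) * (u₃ k * χ k)) else 0) =
      selfJacobi χ * ∑ i ∈ Finset.range n, (i : ℤ_[p]) * χ i ^ 3 *
      (u₁ i * addConv u₂ u₃ (-i) + u₂ i * addConv u₁ u₃ (-i) + u₃ i * addConv u₂ u₁ (-i)) := by
    simp only [mul_add, Finset.sum_add_distrib]
    rw [← p1, ← p2, ← p3]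
    simp only [← Finset.sum_add_distrib]
    refine Finset.sum_congr rfl fun i _ => Finset.sum_congr rfl fun j _ =>
      Finset.sum_congr rfl fun k _ => ?_
    split_ifs <;> ring
  rw [← hsum, hw, hn]
  push_cast
  ring

theorem sum_range_dvd {R : Type*} [AddCommMonoid R] (e M : ℕ) (he : 0 < e) (g : ℕ → R) :
    (∑ i ∈ Finset.range (M * e), if e ∣ i then g i else 0) =
      ∑ k ∈ Finset.range M, g (e * k) := by
  rw [← Finset.sum_filter]
  symm
  refine Finset.sum_nbij' (fun k => e * k) (fun i => i / e) ?_ ?_ ?_ ?_ ?_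
  · intro k hk
    simp only [Finset.mem_range, Finset.mem_filter] at hk ⊢
    exact ⟨by rw [mul_comm M]; exact Nat.mul_lt_mul_of_pos_left hk he, Dvd.intro _ rfl⟩
  · intro i hi
    simp only [Finset.mem_range, Finset.mem_filter] at hi ⊢
    exact Nat.div_lt_of_lt_mul (by rw [mul_comm e]; exact hi.1)
  · intro k _; exact Nat.mul_div_cancel_left k he
  · intro i hi; exact Nat.mul_div_cancel' (Finset.mem_filter.1 hi).2
  · intro k _; rfl

/-- With d = ef, write i = e(a + px) with a < p and x < f. Then χ(i)³ depends only on a, and the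
contribution of epx vanishes because χ³ is odd and so sums to zero. -/
theorem sum_range_dvd_mul_character {d e : ℕ} (χ : ZMod p →*₀ ℤ_[p])
    (hχ : ∀ x, χ (-x) = -χ x) (he : e ∣ d) (hd : 0 < d) :
    (∑ i ∈ Finset.range (p * d), if e ∣ i then (i : ℤ_[p]) * χ i ^ 3 else 0) =
      d * χ e ^ 3 * ∑ x ∈ Finset.range p, (x : ℤ_[p]) * χ x ^ 3 := by
  obtain ⟨f, rfl⟩ := he
  have he0 : 0 < e := pos_of_mul_pos_left hd (Nat.zero_le _)
  rw [show p * (e * f) = f * p * e by ring, sum_range_dvd _ _ he0, sum_range_mul_eq]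
  have hodd : ∑ x ∈ Finset.range p, χ (x : ZMod p) ^ 3 = 0 := by
    rw [sum_range_natCast_zmod p fun x => χ x ^ 3]
    have h : ∑ x : ZMod p, χ x ^ 3 = -∑ x : ZMod p, χ x ^ 3 := by
      rw [← Finset.sum_neg_distrib, ← Equiv.sum_comp (Equiv.neg (ZMod p))]
      refine Finset.sum_congr rfl fun x _ => ?_
      rw [Equiv.neg_apply, hχ]; ring
    exact self_eq_neg.1 h
  have h1 : ∀ a : ℕ, (∑ x ∈ Finset.range f,
      ((e * (a + p * x) : ℕ) : ℤ_[p]) * χ ((e * (a + p * x) : ℕ) : ZMod p) ^ 3) =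
      e * f * χ e ^ 3 * (a * χ a ^ 3) +
        (e * χ e ^ 3 * p * ∑ x ∈ Finset.range f, (x : ℤ_[p])) * χ a ^ 3 := by
    intro a
    have : ∀ x : ℕ, ((e * (a + p * x) : ℕ) : ℤ_[p]) * χ ((e * (a + p * x) : ℕ) : ZMod p) ^ 3 =
        e * χ e ^ 3 * (a * χ a ^ 3) + (e * χ e ^ 3 * p * χ a ^ 3) * x := by
      intro x
      push_cast
      rw [CharP.cast_eq_zero (ZMod p) p, zero_mul, add_zero, map_mul]
      ring
    simp only [this, Finset.sum_add_distrib, ← Finset.mul_sum, Finset.sum_const,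
      Finset.card_range, nsmul_eq_mul]
    ring
  simp only [h1]
  rw [Finset.sum_add_distrib, ← Finset.mul_sum, ← Finset.mul_sum, hodd]
  push_cast
  ring

end Character

/-! ### Periodic weights and their local factors -/

section Weights

variable {p : ℕ} [Fact p.Prime]

/-- The indicator of the residues mod `d` that are not divisible by `q`, where `q ∣ d`. -/
noncomputable def notDvdInd (p q : ℕ) [Fact p.Prime] {d : ℕ} (x : ZMod d) : ℤ_[p] :=
  if (x.cast : ZMod q) = 0 then 0 else 1

/-- The sign `(-1)^x` of a residue modulo an even number. -/
noncomputable def paritySign (p : ℕ) [Fact p.Prime] {d : ℕ} (x : ZMod d) : ℤ_[p] :=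
  if (x.cast : ZMod 2) = 0 then 1 else -1

theorem notDvdInd_natCast {q d : ℕ} (h : q ∣ d) (i : ℕ) :
    notDvdInd p q (i : ZMod d) = if q ∣ i then 0 else 1 := by
  rw [notDvdInd, ZMod.cast_natCast h]
  exact if_congr (ZMod.natCast_eq_zero_iff i q) rfl rfl

theorem paritySign_natCast {d : ℕ} (h : 2 ∣ d) (i : ℕ) :
    paritySign p (i : ZMod d) = if 2 ∣ i then 1 else -1 := by
  rw [paritySign, ZMod.cast_natCast h]
  exact if_congr (ZMod.natCast_eq_zero_iff i 2) rfl rfl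

theorem notDvdInd_neg {q d : ℕ} (h : q ∣ d) (x : ZMod d) :
    notDvdInd p q (-x) = notDvdInd p q x := by
  rw [notDvdInd, notDvdInd, ZMod.cast_neg h]
  exact if_congr neg_eq_zero rfl rfl

theorem paritySign_neg {d : ℕ} (h : 2 ∣ d) (x : ZMod d) :
    paritySign p (-x) = paritySign p x := by
  rw [paritySign, paritySign, ZMod.cast_neg h]
  exact if_congr neg_eq_zero rfl rfl

/-- A residue c modulo q must avoid 0 and l, two distinct values, and each of the remaining q - 2
has m lifts modulo mq. -/
theorem addConv_notDvdInd {q m : ℕ} [Fact q.Prime] [NeZero (m * q)] (l : ZMod (m * q))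
    (hl : (l.cast : ZMod q) ≠ 0) :
    addConv (notDvdInd p q) (notDvdInd p q) l = (m * (q - 2) : ℤ_[p]) := by
  have hq : q ∣ m * q := Dvd.intro_left _ rfl
  set F : ZMod q → ℤ_[p] :=
    fun c => (if c = 0 then 0 else 1) * (if (l.cast : ZMod q) - c = 0 then 0 else 1) with hF
  have h1 : addConv (notDvdInd p q) (notDvdInd p q) l = ∑ y : ZMod (m * q), F y.cast := by
    refine Finset.sum_congr rfl fun y _ => ?_
    simp only [notDvdInd, hF, ZMod.cast_sub hq]
  have h2 : ∑ c : ZMod q, F c = q - 2 := by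
    have : ∀ c, F c = 1 - (if c = 0 then 1 else 0) - (if c = (l.cast : ZMod q) then 1 else 0) := by
      intro c
      simp only [hF, sub_eq_zero]
      by_cases h0 : c = 0
      · simp [h0, hl.symm]
      · by_cases h3 : c = l.cast
        · simp [h3, hl]
        · simp [h0, h3, Ne.symm h3]
    simp only [this, Finset.sum_sub_distrib, Finset.sum_ite_eq', Finset.mem_univ, if_true,
      Finset.sum_const, Finset.card_univ, ZMod.card, nsmul_eq_mul]
    ring
  rw [h1, ← sum_range_natCast_zmod, sum_range_mul_eq, ← h2, ← sum_range_natCast_zmod,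
    Finset.mul_sum]
  refine Finset.sum_congr rfl fun a _ => ?_
  have : ∀ x : ℕ, ((((a + q * x : ℕ) : ZMod (m * q))).cast : ZMod q) = a := by
    intro x
    rw [ZMod.cast_natCast hq]; simp
  simp only [this, Finset.sum_const, Finset.card_range, nsmul_eq_mul]

/-- Translation by the odd period t flips the sign and preserves u and v, so the convolution equals
its own negative. -/
theorem addConv_paritySign_mul {d t : ℕ} [NeZero d] (h2 : 2 ∣ d) (ht : Odd t)
    (u v : ZMod d → ℤ_[p]) (hu : ∀ x, u (x + (t : ZMod d)) = u x)
    (hv : ∀ x, v (x - (t : ZMod d)) = v x)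
    (l : ZMod d) : addConv (fun x => paritySign p x * u x) v l = 0 := by
  have hs : ∀ x : ZMod d, paritySign p (x + (t : ZMod d)) = -paritySign p x := by
    intro x
    have h1 : ((t : ZMod d).cast : ZMod 2) = 1 := by
      rw [ZMod.cast_natCast h2]; exact ZMod.natCast_eq_one_iff_odd.2 ht
    have h3 : ∀ c : ZMod 2, (if c + 1 = 0 then 1 else -1 : ℤ_[p]) =
        -(if c = 0 then 1 else -1) := by
      intro c
      by_cases hc : c = 0
      · simp [hc]
      · have : c = 1 := by revert hc; revert c; decide
        subst this
        rw [if_pos (by decide), if_neg (by decide), neg_neg]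
    rw [paritySign, paritySign, ZMod.cast_add h2, h1]
    exact h3 _
  have h : addConv (fun x => paritySign p x * u x) v l =
      -addConv (fun x => paritySign p x * u x) v l := by
    conv_lhs => rw [addConv, ← Equiv.sum_comp (Equiv.addRight (t : ZMod d))]
    rw [addConv, ← Finset.sum_neg_distrib]
    refine Finset.sum_congr rfl fun y _ => ?_
    rw [Equiv.coe_addRight, hs, hu, show l - (y + t) = (l - y) - t by ring, hv]
    ring
  exact self_eq_neg.1 h

/-- The sum of `x χ(x)³` over residues `0 ≤ x < p`. -/
noncomputable def cubeMoment (χ : ZMod p →*₀ ℤ_[p]) : ℤ_[p] :=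
  ∑ x ∈ Finset.range p, (x : ℤ_[p]) * χ x ^ 3

theorem prime_mul_boxSum_one (χ : ZMod p →*₀ ℤ_[p]) (hχ : ∀ x, χ (-x) = -χ x) :
    (p : ℤ_[p]) * boxSum p p (fun i j k => χ i * χ j * χ k) =
      -(3 * selfJacobi χ * cubeMoment χ) := by
  have h := mul_boxSum_character (d := 1) (Nat.coprime_one_right p) χ hχ
    (fun _ => 1) (fun _ => 1) (fun _ => 1) (fun _ => rfl) (fun _ => rfl) (fun _ => rfl)
  simp only [mul_one, Nat.cast_one, one_mul, addConv, Finset.sum_const, Finset.card_univ,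
    ZMod.card, one_smul] at h
  rw [h, ← Finset.sum_mul, cubeMoment]
  ring

theorem prime_mul_boxSum_notDvdInd {q m : ℕ} [Fact q.Prime] (hm : 0 < m)
    (hd : p.Coprime (m * q)) (χ : ZMod p →*₀ ℤ_[p]) (hχ : ∀ x, χ (-x) = -χ x) :
    (p : ℤ_[p]) * boxSum (p * (m * q)) (p * (m * q))
      (fun i j k => notDvdInd p q (i : ZMod (m * q)) * χ i *
        (notDvdInd p q (j : ZMod (m * q)) * χ j) * (notDvdInd p q (k : ZMod (m * q)) * χ k)) =
      -(3 * selfJacobi χ * cubeMoment χ * (m * (q - 2)) * (1 - χ q ^ 3)) := by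
  have hqp : q.Prime := Fact.out
  have hd0 : 0 < m * q := Nat.mul_pos hm hqp.pos
  have : NeZero (m * q) := ⟨hd0.ne'⟩
  have hq : q ∣ m * q := Dvd.intro_left _ rfl
  have h := mul_boxSum_character hd χ hχ (notDvdInd p q) (notDvdInd p q) (notDvdInd p q)
    (notDvdInd_neg hq) (notDvdInd_neg hq) (notDvdInd_neg hq)
  have hterm : ∀ i : ℕ, (i : ℤ_[p]) * χ i ^ 3 *
      (notDvdInd p q (i : ZMod (m * q)) *
        addConv (notDvdInd p q) (notDvdInd p q) (-i : ZMod (m * q)) +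
       notDvdInd p q (i : ZMod (m * q)) *
        addConv (notDvdInd p q) (notDvdInd p q) (-i : ZMod (m * q)) +
       notDvdInd p q (i : ZMod (m * q)) *
        addConv (notDvdInd p q) (notDvdInd p q) (-i : ZMod (m * q))) =
      3 * (m * (q - 2)) * ((if 1 ∣ i then (i : ℤ_[p]) * χ i ^ 3 else 0) -
        (if q ∣ i then (i : ℤ_[p]) * χ i ^ 3 else 0)) := by
    intro i
    by_cases hi : q ∣ i
    · rw [notDvdInd_natCast hq, if_pos hi, if_pos hi, if_pos (one_dvd i)]; ring
    · rw [notDvdInd_natCast hq, if_neg hi, if_neg hi, if_pos (one_dvd i), addConv_notDvdInd]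
      · ring
      · rw [ZMod.cast_neg hq, ZMod.cast_natCast hq, neg_ne_zero]
        exact fun h0 => hi ((ZMod.natCast_eq_zero_iff i q).1 h0)
  simp only [hterm] at h
  rw [← Finset.mul_sum, Finset.sum_sub_distrib, sum_range_dvd_mul_character χ hχ (one_dvd _) hd0,
    sum_range_dvd_mul_character χ hχ hq hd0, ← cubeMoment] at h
  have hne : ((m * q : ℕ) : ℤ_[p]) ≠ 0 := Nat.cast_ne_zero.2 hd0.ne'
  refine mul_left_cancel₀ hne ?_
  rw [Nat.cast_one, map_one] at h
  linear_combination h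

/-- Only the part weighted by the signed index survives, since the other two contain a vanishing
convolution with the sign. Writing the sign as 2·[2 ∣ i] - 1 and removing multiples of q gives
2χ(2)³ - 1 - 2χ(2q)³ + χ(q)³ = (2χ(2)³ - 1)(1 - χ(q)³). -/
theorem prime_mul_boxSum_paritySign {q m : ℕ} [Fact q.Prime] (hq2 : Odd q) (hm : Odd m)
    (hd : p.Coprime (2 * m * q)) (χ : ZMod p →*₀ ℤ_[p]) (hχ : ∀ x, χ (-x) = -χ x) :
    (p : ℤ_[p]) * boxSum (p * (2 * m * q)) (p * (2 * m * q))
      (fun i j k =>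
        paritySign p (i : ZMod (2 * m * q)) * notDvdInd p q (i : ZMod (2 * m * q)) * χ i *
        (notDvdInd p q (j : ZMod (2 * m * q)) * χ j) *
        (notDvdInd p q (k : ZMod (2 * m * q)) * χ k)) =
      -(2 * selfJacobi χ * cubeMoment χ * (m * (q - 2)) * (1 - χ q ^ 3) * (2 * χ 2 ^ 3 - 1)) := by
  have hqp : q.Prime := Fact.out
  have hd0 : 0 < 2 * m * q := Nat.mul_pos (Nat.mul_pos two_pos hm.pos) hqp.pos
  have : NeZero (2 * m * q) := ⟨hd0.ne'⟩
  have hq : q ∣ 2 * m * q := Dvd.intro_left _ rfl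
  have h2 : 2 ∣ 2 * m * q := ⟨m * q, by ring⟩
  have h2q : 2 * q ∣ 2 * m * q := ⟨m, by ring⟩
  have hcop : Nat.Coprime 2 q := Nat.coprime_two_left.2 hq2
  have hmq : (((m * q : ℕ) : ZMod (2 * m * q)).cast : ZMod q) = 0 := by
    rw [ZMod.cast_natCast hq]; simp
  have hadd : ∀ x : ZMod (2 * m * q),
      notDvdInd p q (x + ((m * q : ℕ) : ZMod (2 * m * q))) = notDvdInd p q x := by
    intro x; rw [notDvdInd, notDvdInd, ZMod.cast_add hq, hmq, add_zero]
  have hsub : ∀ x : ZMod (2 * m * q),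
      notDvdInd p q (x - ((m * q : ℕ) : ZMod (2 * m * q))) = notDvdInd p q x := by
    intro x; rw [notDvdInd, notDvdInd, ZMod.cast_sub hq, hmq, sub_zero]
  have hconv0 := addConv_paritySign_mul h2 (hm.mul hq2) _ _ hadd hsub
  have hconv0' : ∀ l : ZMod (2 * m * q), addConv (notDvdInd p q)
      (fun x => paritySign p x * notDvdInd p q x) l = 0 := by
    intro l
    rw [← hconv0 l, addConv, addConv, ← Equiv.sum_comp (Equiv.subLeft l)]
    refine Finset.sum_congr rfl fun y _ => ?_
    rw [Equiv.subLeft_apply, sub_sub_cancel, mul_comm]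
  have h := mul_boxSum_character hd χ hχ (fun x => paritySign p x * notDvdInd p q x)
    (notDvdInd p q) (notDvdInd p q) (fun x => by rw [paritySign_neg h2, notDvdInd_neg hq])
    (notDvdInd_neg hq) (notDvdInd_neg hq)
  have hterm : ∀ i : ℕ, (i : ℤ_[p]) * χ i ^ 3 *
      (paritySign p (i : ZMod (2 * m * q)) * notDvdInd p q (i : ZMod (2 * m * q)) *
        addConv (notDvdInd p q) (notDvdInd p q) (-i : ZMod (2 * m * q)) +
       notDvdInd p q (i : ZMod (2 * m * q)) *
        addConv (fun x => paritySign p x * notDvdInd p q x) (notDvdInd p q)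
          (-i : ZMod (2 * m * q)) +
       notDvdInd p q (i : ZMod (2 * m * q)) *
        addConv (notDvdInd p q) (fun x => paritySign p x * notDvdInd p q x)
          (-i : ZMod (2 * m * q))) =
      2 * (m * (q - 2)) * (2 * (if 2 ∣ i then (i : ℤ_[p]) * χ i ^ 3 else 0) -
        (if 1 ∣ i then (i : ℤ_[p]) * χ i ^ 3 else 0) -
        2 * (if 2 * q ∣ i then (i : ℤ_[p]) * χ i ^ 3 else 0) +
        (if q ∣ i then (i : ℤ_[p]) * χ i ^ 3 else 0)) := by
    intro i
    rw [hconv0, hconv0', paritySign_natCast h2, notDvdInd_natCast hq, if_pos (one_dvd i)]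
    by_cases hi : q ∣ i
    · by_cases hi2 : 2 ∣ i
      · have : 2 * q ∣ i := hcop.mul_dvd_of_dvd_of_dvd hi2 hi
        simp only [if_pos hi, if_pos hi2, if_pos this]; ring
      · have : ¬ 2 * q ∣ i := fun hh => hi2 (dvd_of_mul_right_dvd hh)
        simp only [if_pos hi, if_neg hi2, if_neg this]; ring
    · have : ¬ 2 * q ∣ i := fun hh => hi (dvd_of_mul_left_dvd hh)
      rw [addConv_notDvdInd]
      · simp only [if_neg hi, if_neg this]
        push_cast
        split_ifs <;> ring
      · rw [ZMod.cast_neg hq, ZMod.cast_natCast hq, neg_ne_zero]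
        exact fun h0 => hi ((ZMod.natCast_eq_zero_iff i q).1 h0)
  simp only [hterm] at h
  rw [← Finset.mul_sum, Finset.sum_add_distrib, Finset.sum_sub_distrib, Finset.sum_sub_distrib,
    ← Finset.mul_sum, ← Finset.mul_sum,
    sum_range_dvd_mul_character χ hχ (one_dvd _) hd0,
    sum_range_dvd_mul_character χ hχ h2 hd0, sum_range_dvd_mul_character χ hχ h2q hd0,
    sum_range_dvd_mul_character χ hχ hq hd0, ← cubeMoment] at h
  have hne : ((2 * m * q : ℕ) : ℤ_[p]) ≠ 0 := Nat.cast_ne_zero.2 hd0.ne'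
  refine mul_left_cancel₀ hne ?_
  rw [Nat.cast_one, map_one, Nat.cast_mul 2 q, map_mul, Nat.cast_ofNat] at h
  linear_combination h

theorem boxSum_notDvdInd {q m : ℕ} [Fact q.Prime] (hm : 0 < m)
    (hd : p.Coprime (m * q)) (χ : ZMod p →*₀ ℤ_[p]) (hχ : ∀ x, χ (-x) = -χ x) :
    boxSum (p * (m * q)) (p * (m * q))
      (fun i j k => notDvdInd p q (i : ZMod (m * q)) * χ i *
        (notDvdInd p q (j : ZMod (m * q)) * χ j) * (notDvdInd p q (k : ZMod (m * q)) * χ k)) =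
      m * (q - 2) * (1 - χ q ^ 3) * boxSum p p (fun i j k => χ i * χ j * χ k) := by
  have hp0 : (p : ℤ_[p]) ≠ 0 := Nat.cast_ne_zero.2 (Fact.out : p.Prime).ne_zero
  refine mul_left_cancel₀ hp0 ?_
  rw [prime_mul_boxSum_notDvdInd hm hd χ hχ]
  linear_combination -(m * (q - 2) * (1 - χ q ^ 3)) * prime_mul_boxSum_one χ hχ

/-- The factor 3 stays on the left because p may be 3. -/
theorem three_mul_boxSum_paritySign {q m : ℕ} [Fact q.Prime] (hq2 : Odd q) (hm : Odd m)
    (hd : p.Coprime (2 * m * q)) (χ : ZMod p →*₀ ℤ_[p]) (hχ : ∀ x, χ (-x) = -χ x) :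
    3 * boxSum (p * (2 * m * q)) (p * (2 * m * q))
      (fun i j k =>
        paritySign p (i : ZMod (2 * m * q)) * notDvdInd p q (i : ZMod (2 * m * q)) * χ i *
        (notDvdInd p q (j : ZMod (2 * m * q)) * χ j) *
        (notDvdInd p q (k : ZMod (2 * m * q)) * χ k)) =
      2 * (m * (q - 2)) * (1 - χ q ^ 3) * (2 * χ 2 ^ 3 - 1) *
        boxSum p p (fun i j k => χ i * χ j * χ k) := by
  have hp0 : (p : ℤ_[p]) ≠ 0 := Nat.cast_ne_zero.2 (Fact.out : p.Prime).ne_zero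
  refine mul_left_cancel₀ hp0 ?_
  linear_combination 3 * prime_mul_boxSum_paritySign hq2 hm hd χ hχ
    - 2 * (m * (q - 2)) * (1 - χ q ^ 3) * (2 * χ 2 ^ 3 - 1) * prime_mul_boxSum_one χ hχ

/-- Since χ(2) ≡ 1/2, the right side is ≡ -3/4, so y ≡ -1/4 when 3 is a unit. For p = 3, χ(2) =
χ(-1) = -1 exactly, and y = -1 works. -/
theorem exists_three_mul_eq_teichmullerInv_two (hp2 : Odd p) :
    ∃ y : ℤ_[p], 3 * y = 2 * teichmullerInv p 2 ^ 3 - 1 ∧ (p : ℤ_[p]) ∣ 4 * y + 1 := by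
  have hp : p.Prime := Fact.out
  have hp_ne : p ≠ 2 := by rintro rfl; exact absurd hp2 (by decide)
  by_cases h3 : p = 3
  · have h2 : (2 : ZMod p) = -1 := by
      have : ((3 : ℕ) : ZMod p) = 0 := by rw [← h3]; exact CharP.cast_eq_zero _ _
      push_cast at this
      linear_combination this
    refine ⟨-1, ?_, ?_⟩
    · rw [h2, teichmullerInv_neg hp2, map_one]; norm_num
    · have : (p : ℤ_[p]) = 3 := by exact_mod_cast congrArg (Nat.cast (R := ℤ_[p])) h3
      rw [this]; norm_num
  · have hu : IsUnit (3 : ℤ_[p]) := by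
      have : IsUnit ((3 : ℕ) : ℤ_[p]) := by
        rw [isUnit_natCast_padicInt, Nat.prime_dvd_prime_iff_eq hp Nat.prime_three]
        exact h3
      simpa using this
    obtain ⟨y, hy⟩ := hu.dvd (a := 2 * teichmullerInv p 2 ^ 3 - 1)
    refine ⟨y, hy.symm, ?_⟩
    rw [← hu.dvd_mul_left]
    have : 3 * (4 * y + 1) = 8 * teichmullerInv p 2 ^ 3 - 1 := by linear_combination -4 * hy
    rw [this, dvd_iff_toZMod_eq_zero]
    have h2 : (2 : ZMod p) ≠ 0 := by
      intro h
      have : ((2 : ℕ) : ZMod p) = 0 := by exact_mod_cast h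
      rw [ZMod.natCast_eq_zero_iff, Nat.prime_dvd_prime_iff_eq hp Nat.prime_two] at this
      exact hp_ne this
    rw [map_sub, map_mul, map_pow, toZMod_teichmullerInv, map_one, map_ofNat]
    field_simp
    norm_num

end Weights

/-! ### The base sum modulo p and Bernoulli numbers -/

section BernoulliSum

variable {p : ℕ} [Fact p.Prime]

/-- The recursion for the k-th Bernoulli number divides only by k + 1, a p-adic unit in this range.
-/
theorem exists_padicInt_eq_bernoulli {k : ℕ} (hk : k + 1 < p) :
    ∃ b : ℤ_[p], (b : ℚ_[p]) = ((bernoulli k : ℚ) : ℚ_[p]) := by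
  induction k using Nat.strong_induction_on with
  | _ k ih =>
    choose! b hb using ih
    rcases Nat.eq_zero_or_pos k with rfl | hk0
    · exact ⟨1, by simp⟩
    have hu : ¬ p ∣ k + 1 := Nat.not_dvd_of_pos_of_lt k.succ_pos hk
    refine ⟨-(recip p (k + 1) * ∑ i ∈ Finset.range k, ((k + 1).choose i : ℤ_[p]) * b i), ?_⟩
    have hs := sum_bernoulli (k + 1)
    rw [Finset.sum_range_succ, Nat.choose_succ_self_right, if_neg (by omega)] at hs
    have hs' := congrArg (Rat.cast (K := ℚ_[p])) hs
    have hr := congrArg (fun z : ℤ_[p] => (z : ℚ_[p])) (mul_recip hu)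
    push_cast at hs' hr ⊢
    rw [PadicInt.coe_sum]
    push_cast
    have hsum : ∑ i ∈ Finset.range k, ((k + 1).choose i : ℚ_[p]) * (b i : ℚ_[p]) =
        ∑ i ∈ Finset.range k, ((k + 1).choose i : ℚ_[p]) * ((bernoulli i : ℚ) : ℚ_[p]) := by
      refine Finset.sum_congr rfl fun i hi => ?_
      rw [hb i (Finset.mem_range.1 hi) (by have := Finset.mem_range.1 hi; omega)]
    rw [hsum]
    linear_combination -(recip p (k + 1) : ℚ_[p]) * hs' + (bernoulli k : ℚ_[p]) * hr

/-- The harmonic numbers mod `p` as polynomials, by Faulhaber's formula. -/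
theorem neg_sum_inv_eq (hp2 : Odd p) (b : ℕ → ℤ_[p])
    (hb : ∀ k, k + 1 < p → (b k : ℚ_[p]) = ((bernoulli k : ℚ) : ℚ_[p])) (l : ℕ) :
    -∑ i ∈ Finset.range l, ((i : ZMod p))⁻¹ =
      ∑ r ∈ Finset.range (p - 1), PadicInt.toZMod (b r) * ((p - 1).choose r : ZMod p) *
        (l : ZMod p) ^ (p - 1 - r) := by
  have hp : p.Prime := Fact.out
  have hp3 : 3 ≤ p := by
    have := hp.two_le
    rcases hp2 with ⟨t, ht⟩; omega
  -- Modulo p, 1/i = i^(p-2), and the factor p - 1 clearing the denominator becomes -1.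
  have h := sum_range_pow l (p - 2)
  have hp0 : (((p - 2 : ℕ) : ℚ) + 1) ≠ 0 := by positivity
  rw [show p - 2 + 1 = p - 1 by omega] at h
  have h1 : ((p - 1 : ℕ) : ℚ) * ∑ k ∈ Finset.range l, (k : ℚ) ^ (p - 2) =
      ∑ i ∈ Finset.range (p - 1), bernoulli i * ((p - 1).choose i) * (l : ℚ) ^ (p - 1 - i) := by
    rw [h, Finset.mul_sum]
    refine Finset.sum_congr rfl fun i _ => ?_
    rw [show ((p - 1 : ℕ) : ℚ) = ((p - 2 : ℕ) : ℚ) + 1 by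
      rw [show p - 1 = p - 2 + 1 by omega]; push_cast; ring]
    field_simp
  have h2 : ((p - 1 : ℕ) : ℤ_[p]) * ∑ k ∈ Finset.range l, (k : ℤ_[p]) ^ (p - 2) =
      ∑ i ∈ Finset.range (p - 1), b i * ((p - 1).choose i) * (l : ℤ_[p]) ^ (p - 1 - i) := by
    apply PadicInt.ext
    have h3 := congrArg (Rat.cast (K := ℚ_[p])) h1
    push_cast at h3 ⊢
    rw [PadicInt.coe_sum, PadicInt.coe_sum]
    push_cast
    rw [h3]
    refine Finset.sum_congr rfl fun i hi => ?_
    rw [hb i (by have := Finset.mem_range.1 hi; omega)]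
  have h4 := congrArg PadicInt.toZMod h2
  simp only [map_mul, map_sum, map_pow, map_natCast] at h4
  rw [← h4, Nat.cast_sub hp.one_le, CharP.cast_eq_zero (ZMod p) p, Nat.cast_one, zero_sub,
    neg_one_mul]
  congr 1
  refine Finset.sum_congr rfl fun i _ => ?_
  by_cases h0 : (i : ZMod p) = 0
  · rw [h0, inv_zero, zero_pow (by omega)]
  · refine inv_eq_of_mul_eq_one_right ?_
    rw [← pow_succ', show p - 2 + 1 = p - 1 by omega, ZMod.pow_card_sub_one_eq_one h0]

/-- This is a power sum of exponent t - 2, lying between -1 and p - 3; it vanishes over the nonzero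
residues unless the exponent is 0. -/
theorem sum_inv_sq_mul_pow (hp2 : Odd p) {t : ℕ} (ht : 1 ≤ t) (ht' : t ≤ p - 1) :
    ∑ l ∈ Finset.range p, ((l : ZMod p)⁻¹) ^ 2 * (l : ZMod p) ^ t = if t = 2 then -1 else 0 := by
  have hp : p.Prime := Fact.out
  have hp3 : 3 ≤ p := by
    have := hp.two_le
    rcases hp2 with ⟨t, ht⟩; omega
  rw [sum_range_natCast_zmod p fun x => x⁻¹ ^ 2 * x ^ t]
  rcases lt_trichotomy t 2 with h | h | h
  · obtain rfl : t = 1 := by omega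
    rw [if_neg (by omega), ← Equiv.sum_comp (Equiv.inv (ZMod p)),
      ← FiniteField.sum_pow_lt_card_sub_one (ZMod p) 1 (by rw [ZMod.card]; omega)]
    refine Finset.sum_congr rfl fun x _ => ?_
    rw [Equiv.inv_apply, inv_inv]
    by_cases hx : x = 0
    · simp [hx]
    · field_simp
  · subst h
    have : ∀ x : ZMod p, x⁻¹ ^ 2 * x ^ 2 = 1 - if x = 0 then 1 else 0 := by
      intro x
      by_cases hx : x = 0
      · simp [hx]
      · rw [if_neg hx]; field_simp; ring
    simp only [this]
    simp
  · rw [if_neg (by omega),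
      ← FiniteField.sum_pow_lt_card_sub_one (ZMod p) (t - 2) (by rw [ZMod.card]; omega)]
    refine Finset.sum_congr rfl fun x _ => ?_
    by_cases hx : x = 0
    · rw [hx, zero_pow (by omega), zero_pow (by omega), mul_zero]
    · obtain ⟨s, rfl⟩ : ∃ s, t = s + 2 := ⟨t - 2, by omega⟩
      rw [Nat.add_sub_cancel, pow_add]; field_simp

/-- Put l = i + j, so that k ≡ -l, and use the partial fractions 1/(i(l-i)) = (1/l)(1/i + 1/(l-i)).
-/
theorem boxSum_inv_eq :
    boxSum p p (fun i j k => (i : ZMod p)⁻¹ * (j : ZMod p)⁻¹ * (k : ZMod p)⁻¹) =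
      -2 * ∑ l ∈ Finset.range p, (l : ZMod p)⁻¹ ^ 2 * ∑ i ∈ Finset.range l, (i : ZMod p)⁻¹ := by
  have hlt : ∀ i < p, 0 < i → (i : ZMod p) ≠ 0 := fun i hi h0 h =>
    Nat.not_dvd_of_pos_of_lt h0 hi ((ZMod.natCast_eq_zero_iff i p).1 h)
  have hconv : ∀ l < p, ∑ i ∈ Finset.range l, (i : ZMod p)⁻¹ * ((l - i : ℕ) : ZMod p)⁻¹ =
      2 * (l : ZMod p)⁻¹ * ∑ i ∈ Finset.range l, (i : ZMod p)⁻¹ := by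
    intro l hl
    -- The value at l is set to 0 so that the summand vanishes at both ends, as the reflection
    -- requires.
    have hr := sum_range_reflect_of_zero l (fun i => if i = l then 0 else (i : ZMod p)⁻¹)
      (by simp) (by simp)
    have h1 : ∑ i ∈ Finset.range l, (if i = l then 0 else (i : ZMod p)⁻¹) =
        ∑ i ∈ Finset.range l, (i : ZMod p)⁻¹ :=
      Finset.sum_congr rfl fun i hi => if_neg (Finset.mem_range.1 hi).ne
    rw [h1] at hr
    rw [two_mul, add_mul]
    conv_rhs => rw [hr]
    conv_rhs => enter [1]; rw [← hr]
    rw [Finset.mul_sum, Finset.mul_sum, ← Finset.sum_add_distrib]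
    refine Finset.sum_congr rfl fun i hi => ?_
    have hi := Finset.mem_range.1 hi
    rcases Nat.eq_zero_or_pos i with rfl | h0
    · simp
    · rw [if_neg (by omega)]
      have e1 := hlt i (by omega) h0
      have e2 := hlt (l - i) (by omega) (by omega)
      have e3 := hlt l hl (by omega)
      rw [Nat.cast_sub hi.le] at e2 ⊢
      field_simp
      ring
  have h1 : boxSum p p (fun i j k => (i : ZMod p)⁻¹ * (j : ZMod p)⁻¹ * (k : ZMod p)⁻¹) =
      ∑ k ∈ Finset.range p, (k : ZMod p)⁻¹ *
        ∑ i ∈ Finset.range (p - k), (i : ZMod p)⁻¹ * ((p - k - i : ℕ) : ZMod p)⁻¹ := by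
    rw [boxSum_perm_thd, boxSum]
    refine Finset.sum_congr rfl fun k hk => ?_
    have hk := Finset.mem_range.1 hk
    rw [Finset.sum_comm, Finset.mul_sum]
    rcases Nat.eq_zero_or_pos k with rfl | hk0
    · simp
    have hsub : Finset.range (p - k) ⊆ Finset.range p :=
      Finset.range_subset_range.2 (Nat.sub_le _ _)
    symm
    rw [← Finset.sum_subset hsub]
    · refine Finset.sum_congr rfl fun i hi => ?_
      have hi := Finset.mem_range.1 hi
      rw [Finset.sum_eq_single (p - k - i)]
      · rw [if_pos (by omega)]; ring
      · intro j _ hj; exact if_neg (by omega)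
      · intro hj; simp only [Finset.mem_range] at hj; omega
    · intro i _ hi
      simp only [Finset.mem_range] at hi
      refine Finset.sum_eq_zero fun j _ => ?_
      split_ifs with hs
      -- Here i ≥ p - k forces i = p - k and j = 0, where the inverse is 0 by convention.
      · have : j = 0 := by omega
        simp [this]
      · rfl
  rw [h1, sum_range_reflect_of_zero _ _ (by simp) (by simp), Finset.mul_sum]
  refine Finset.sum_congr rfl fun l hl => ?_
  have hl := Finset.mem_range.1 hl
  rw [Nat.sub_sub_self hl.le, hconv l hl, Nat.cast_sub hl.le, CharP.cast_eq_zero (ZMod p) p,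
    zero_sub, inv_neg]
  ring

theorem dvd_boxSum_recip_add_bernoulli (hp2 : Odd p) (b : ℤ_[p])
    (hb : (b : ℚ_[p]) = ((bernoulli (p - 3) : ℚ) : ℚ_[p])) :
    (p : ℤ_[p]) ∣ boxSum p p (fun i j k => recip p i * recip p j * recip p k) + 2 * b := by
  have hp : p.Prime := Fact.out
  have hp3 : 3 ≤ p := by
    have := hp.two_le
    rcases hp2 with ⟨t, ht⟩; omega
  have hex : ∀ k, ∃ c : ℤ_[p], k + 1 < p → (c : ℚ_[p]) = ((bernoulli k : ℚ) : ℚ_[p]) := by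
    intro k
    by_cases hk : k + 1 < p
    · obtain ⟨c, hc⟩ := exists_padicInt_eq_bernoulli hk; exact ⟨c, fun _ => hc⟩
    · exact ⟨0, fun h => absurd h hk⟩
  choose c hc using hex
  have hbc : c (p - 3) = b := PadicInt.ext ((hc (p - 3) (by omega)).trans hb.symm)
  rw [dvd_iff_toZMod_eq_zero, map_add, map_mul, ← hbc]
  have hmap : PadicInt.toZMod (boxSum p p fun i j k => recip p i * recip p j * recip p k) =
      boxSum p p (fun i j k => (i : ZMod p)⁻¹ * (j : ZMod p)⁻¹ * (k : ZMod p)⁻¹) := by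
    simp only [boxSum, map_sum]
    refine Finset.sum_congr rfl fun i _ => Finset.sum_congr rfl fun j _ =>
      Finset.sum_congr rfl fun k _ => ?_
    rw [apply_ite PadicInt.toZMod, map_mul, map_mul, toZMod_recip, toZMod_recip, toZMod_recip,
      map_zero]
  have hH : ∀ l : ℕ, ∑ i ∈ Finset.range l, (i : ZMod p)⁻¹ =
      -∑ r ∈ Finset.range (p - 1), PadicInt.toZMod (c r) * ((p - 1).choose r : ZMod p) *
        (l : ZMod p) ^ (p - 1 - r) := by
    intro l
    rw [← neg_sum_inv_eq hp2 c hc l, neg_neg]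
  have hfac : ∀ (A : ZMod p) (t : ℕ),
      ∑ l ∈ Finset.range p, (l : ZMod p)⁻¹ ^ 2 * (A * (l : ZMod p) ^ t) =
        A * ∑ l ∈ Finset.range p, (l : ZMod p)⁻¹ ^ 2 * (l : ZMod p) ^ t := by
    intro A t
    rw [Finset.mul_sum]
    exact Finset.sum_congr rfl fun l _ => mul_left_comm _ _ _
  have hsum : ∑ l ∈ Finset.range p, (l : ZMod p)⁻¹ ^ 2 * ∑ i ∈ Finset.range l, (i : ZMod p)⁻¹ =
      PadicInt.toZMod (c (p - 3)) * ((p - 1).choose (p - 3) : ZMod p) := by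
    simp only [hH, mul_neg, Finset.sum_neg_distrib, Finset.mul_sum]
    -- Only the exponent p - 1 - r = 2 gives a nonzero power sum, which singles out the index p - 3.
    rw [Finset.sum_comm, neg_eq_iff_eq_neg, Finset.sum_eq_single (p - 3)]
    · have := sum_inv_sq_mul_pow (p := p) hp2 (t := 2) (by omega) (by omega)
      rw [if_pos rfl] at this
      rw [show p - 1 - (p - 3) = 2 by omega]
      rw [hfac, this]
      ring
    · intro r hr hne
      have hr := Finset.mem_range.1 hr
      have := sum_inv_sq_mul_pow (p := p) hp2 (t := p - 1 - r) (by omega) (by omega)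
      rw [if_neg (by omega)] at this
      rw [hfac, this, mul_zero]
    · intro h; simp only [Finset.mem_range] at h; omega
  -- The binomial coefficient (p-1)(p-2)/2 is ≡ (-1)(-2)/2 = 1.
  have hchoose : 2 * ((p - 1).choose (p - 3) : ZMod p) = 2 := by
    rw [show (p - 1).choose (p - 3) = (p - 1).choose 2 from
      Nat.choose_symm_of_eq_add (by omega), Nat.choose_two_right]
    obtain ⟨t, ht⟩ := hp2
    have h1 : (p - 1) * (p - 1 - 1) / 2 = t * (2 * t - 1) := by
      rw [ht, Nat.add_sub_cancel, mul_assoc, Nat.mul_div_cancel_left _ two_pos]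
    have h2 : (2 * t + 1 : ZMod p) = 0 := by
      have := CharP.cast_eq_zero (ZMod p) p
      have h3 := congrArg (Nat.cast (R := ZMod p)) ht
      rw [this] at h3; push_cast at h3; exact h3.symm
    rw [h1, Nat.cast_mul, Nat.cast_sub (by omega)]
    push_cast
    linear_combination (2 * t - 2 : ZMod p) * h2
  rw [hmap, boxSum_inv_eq, hsum, map_ofNat]
  linear_combination -PadicInt.toZMod (c (p - 3)) * hchoose

end BernoulliSum

/-! ### From p-adic integers back to rational congruences -/

section Conversion

variable {p : ℕ} [Fact p.Prime]

theorem coe_recip {i : ℕ} (h : ¬ p ∣ i) : ((recip p i : ℤ_[p]) : ℚ_[p]) = (i : ℚ_[p])⁻¹ := by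
  refine eq_inv_of_mul_eq_one_right ?_
  have := congrArg (fun z : ℤ_[p] => (z : ℚ_[p])) (mul_recip h)
  push_cast at this
  exact this

/-- A sum over `coprimeTriples`, viewed in `ℤ_[p]`. -/
theorem coe_boxSum_eq_sum_coprimeTriples {n N q : ℕ} (w : ℕ → ℤ) (U V : ℕ → ℤ_[p])
    (hN : ∀ i, i.Coprime N ↔ ¬ p ∣ i ∧ ¬ q ∣ i) (hV : ∀ i, V i = if q ∣ i then 0 else 1)
    (hU : ∀ i, U i = if q ∣ i then 0 else (w i : ℤ_[p])) :
    ((boxSum n n (fun i j k => U i * recip p i * (V j * recip p j) * (V k * recip p k)) :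
      ℤ_[p]) : ℚ_[p]) =
    ((∑ t ∈ coprimeTriples n N,
      (w t.1 : ℚ) / ((t.1 : ℚ) * (t.2.1 : ℚ) * (t.2.2 : ℚ)) : ℚ) : ℚ_[p]) := by
  have hU0 : ∀ i, ¬ i.Coprime N → U i * recip p i = 0 := by
    intro i hi
    rw [hN, not_and_or, not_not, not_not] at hi
    rcases hi with hi | hi
    · rw [recip_eq_zero hi, mul_zero]
    · rw [hU, if_pos hi, zero_mul]
  have hV0 : ∀ i, ¬ i.Coprime N → V i * recip p i = 0 := by
    intro i hi
    rw [hN, not_and_or, not_not, not_not] at hi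
    rcases hi with hi | hi
    · rw [recip_eq_zero hi, mul_zero]
    · rw [hV, if_pos hi, zero_mul]
  have hpos : ∀ i : ℕ, i.Coprime N → 0 < i := by
    intro i hi
    rcases Nat.eq_zero_or_pos i with rfl | h
    · exact absurd (dvd_zero p) ((hN 0).1 hi).1
    · exact h
  have h1 : boxSum n n (fun i j k => U i * recip p i * (V j * recip p j) * (V k * recip p k)) =
      ∑ t ∈ coprimeTriples n N,
        U t.1 * recip p t.1 * (V t.2.1 * recip p t.2.1) * (V t.2.2 * recip p t.2.2) := by
    have hsub : coprimeTriples n N ⊆ Finset.range n ×ˢ Finset.range n ×ˢ Finset.range n := by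
      rintro ⟨i, j, k⟩ ht
      simp only [coprimeTriples, Finset.mem_filter, Finset.mem_product, Finset.mem_Icc] at ht
      simp only [Finset.mem_product, Finset.mem_range]
      omega
    have h2 : boxSum n n
        (fun i j k => U i * recip p i * (V j * recip p j) * (V k * recip p k)) =
        ∑ t ∈ Finset.range n ×ˢ Finset.range n ×ˢ Finset.range n,
          if t.1 + t.2.1 + t.2.2 = n then
            U t.1 * recip p t.1 * (V t.2.1 * recip p t.2.1) * (V t.2.2 * recip p t.2.2)
          else 0 := by
      rw [Finset.sum_product]
      simp only [Finset.sum_product]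
      rfl
    rw [h2, ← Finset.sum_subset hsub]
    · refine Finset.sum_congr rfl fun t ht => if_pos ?_
      exact (Finset.mem_filter.1 ht).2.1
    · rintro ⟨i, j, k⟩ - ht
      split_ifs with hs
      · simp only [coprimeTriples, Finset.mem_filter, Finset.mem_product, Finset.mem_Icc] at ht hs
        by_cases hi : i.Coprime N
        · by_cases hj : j.Coprime N
          · by_cases hk : k.Coprime N
            · have := hpos i hi
              have := hpos j hj
              have := hpos k hk
              exact absurd ⟨by omega, hs, hi, hj, hk⟩ ht
            · simp [hV0 k hk]
          · simp [hV0 j hj]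
        · simp [hU0 i hi]
      · rfl
  rw [h1, PadicInt.coe_sum, Rat.cast_sum]
  refine Finset.sum_congr rfl fun t ht => ?_
  obtain ⟨-, -, hi, hj, hk⟩ := Finset.mem_filter.1 ht
  rw [hN] at hi hj hk
  rw [hU, hV, hV, if_neg hi.2, if_neg hj.2, if_neg hk.2]
  push_cast
  rw [coe_recip hi.1, coe_recip hj.1, coe_recip hk.1]
  field_simp

theorem not_dvd_den_of_coe_eq {x : ℚ} {X : ℤ_[p]} (hX : (X : ℚ_[p]) = (x : ℚ_[p])) :
    ¬ p ∣ x.den := by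
  intro h
  have h1 : (x.den : ℤ_[p]) * X = x.num := by
    apply PadicInt.ext
    push_cast
    rw [hX]
    exact_mod_cast x.den_mul_eq_num
  have h2 : (p : ℤ_[p]) ∣ (x.num : ℤ_[p]) := by
    rw [← h1]; exact ((natCast_dvd_iff _).2 h).mul_right _
  have h3 : (p : ℤ) ∣ x.num := by
    have := (PadicInt.pow_p_dvd_int_iff (p := p) 1 x.num).1 (by simpa using h2)
    simpa using this
  have h4 : p ∣ x.num.natAbs := Int.natCast_dvd.1 h3
  exact (Fact.out : p.Prime).not_dvd_one (x.reduced ▸ Nat.dvd_gcd h4 h)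

theorem ratModEq_of_dvd {x y : ℚ} {X Y : ℤ_[p]} {m : ℕ} (hX : (X : ℚ_[p]) = (x : ℚ_[p]))
    (hY : (Y : ℚ_[p]) = (y : ℚ_[p])) (h : (p : ℤ_[p]) ^ m ∣ X - Y) : RatModEq (p ^ m) x y := by
  have hp : p.Prime := Fact.out
  refine ⟨((hp.coprime_iff_not_dvd.2 (not_dvd_den_of_coe_eq hX)).symm).pow_right m,
    ((hp.coprime_iff_not_dvd.2 (not_dvd_den_of_coe_eq hY)).symm).pow_right m, ?_⟩
  have h1 : ((x - y).den : ℤ_[p]) * (X - Y) = (x - y).num := by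
    apply PadicInt.ext
    push_cast
    rw [hX, hY]
    exact_mod_cast (x - y).den_mul_eq_num
  have h2 : (p : ℤ_[p]) ^ m ∣ ((x - y).num : ℤ_[p]) := by
    rw [← h1]; exact h.mul_left _
  exact_mod_cast (PadicInt.pow_p_dvd_int_iff (p := p) m _).1 h2

end Conversion

/-! ### Assembling the congruences -/

theorem coprime_iff_of_primes {p q a c i : ℕ} (hp : p.Prime) (hq : q.Prime) :
    i.Coprime (p ^ (a + 1) * q ^ (c + 1)) ↔ ¬ p ∣ i ∧ ¬ q ∣ i := by
  rw [Nat.coprime_mul_iff_right, Nat.coprime_pow_right_iff a.succ_pos,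
    Nat.coprime_pow_right_iff c.succ_pos, Nat.coprime_comm, hp.coprime_iff_not_dvd,
    Nat.coprime_comm, hq.coprime_iff_not_dvd]

/-- The congruences modulo `P ^ (a + 1)` obtained from `P ^ a` times congruences modulo `P`. -/
theorem dvd_sub_of_dvd_sub_pow_mul {R : Type*} [CommRing R] [IsDomain R] [CharZero R]
    {P A Z SA SZ TA TZ S T M Q x w y r b h : R} {a : ℕ}
    (lA : P ^ (a + 1) ∣ A - P ^ a * SA) (lZ : P ^ (a + 1) ∣ Z - P ^ a * SZ)
    (rA : P ∣ SA - TA) (rZ : P ∣ SZ - TZ) (rS : P ∣ S - T)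
    (eA : 3 * TA = 2 * (M * (Q - 2)) * (1 - x ^ 3) * (2 * w ^ 3 - 1) * T)
    (eZ : TZ = M * (Q - 2) * (1 - x ^ 3) * T)
    (hy : 3 * y = 2 * w ^ 3 - 1) (hy' : P ∣ 4 * y + 1) (hS : P ∣ S + 2 * b)
    (hx : P ∣ x ^ 3 - r ^ 3) (hh : 2 * h = 1) :
    P ^ (a + 1) ∣ A - -(h * Z) ∧
      P ^ (a + 1) ∣ -(h * Z) - (Q - 2) * (1 - r ^ 3) * P ^ a * M * b := by
  have hpow : P ^ (a + 1) = P ^ a * P := pow_succ P a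
  -- The exact ratio TA/TZ is (2/3)(2w³ - 1) = 2y, which is ≡ -1/2 = -h modulo P.
  have hTA : TA = 2 * y * TZ := by
    refine mul_left_cancel₀ (OfNat.ofNat_ne_zero 3 : (3 : R) ≠ 0) ?_
    linear_combination eA - 6 * y * eZ - 2 * M * (Q - 2) * (1 - x ^ 3) * T * hy
  have h1 : P ∣ SA + h * SZ := by
    have := dvd_add (dvd_add rA (rZ.mul_left h)) (hy'.mul_left (h * TZ))
    convert this using 1
    linear_combination hTA - 2 * y * TZ * hh
  -- Replace SZ by TZ, then T by S ≡ -2b, then x³ by r³; the factor -2b cancels against -h.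
  have h2 : P ∣ -(h * SZ) - (Q - 2) * (1 - r ^ 3) * M * b := by
    have := dvd_add (dvd_add (rZ.mul_left (-h)) ((dvd_sub rS hS).mul_left
      (h * (M * (Q - 2) * (1 - x ^ 3))))) (hx.mul_left (-(M * (Q - 2) * b)))
    convert this using 1
    linear_combination -h * eZ + M * (Q - 2) * (1 - x ^ 3) * b * hh
  constructor
  · have := dvd_add (dvd_add lA (lZ.mul_left h)) (hpow ▸ mul_dvd_mul_left (P ^ a) h1)
    convert this using 1
    ring
  · have := dvd_add (lZ.mul_left (-h)) (hpow ▸ mul_dvd_mul_left (P ^ a) h2)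
    convert this using 1
    ring

theorem theorem1 (p q α β : ℕ) (hp : p.Prime) (hq : q.Prime) (hp2 : Odd p) (hq2 : Odd q)
    (hpq : p ≠ q) (hα : 0 < α) (hβ : 0 < β) :
    RatModEq (p ^ α) (alternatingSum (2 * p ^ α * q ^ β) (p * q))
        (-(1 / 2) * harmonicZ (p ^ α * q ^ β)) ∧
      RatModEq (p ^ α) (-(1 / 2) * harmonicZ (p ^ α * q ^ β))
        (((q : ℚ) - 2) * (1 - 1 / (q : ℚ) ^ 3) * (p : ℚ) ^ (α - 1) * (q : ℚ) ^ (β - 1)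
          * bernoulli (p - 3)) := by
  have : Fact p.Prime := ⟨hp⟩
  have : Fact q.Prime := ⟨hq⟩
  obtain ⟨a, rfl⟩ : ∃ a, α = a + 1 := ⟨α - 1, by omega⟩
  obtain ⟨c, rfl⟩ : ∃ c, β = c + 1 := ⟨β - 1, by omega⟩
  have hp3 : 3 ≤ p := by
    have := hp.two_le
    rcases hp2 with ⟨t, ht⟩; omega
  have hpq' : ¬ p ∣ q := fun h => hpq ((Nat.prime_dvd_prime_iff_eq hp hq).1 h)
  have hp_two : ¬ p ∣ 2 := fun h => by
    have := Nat.le_of_dvd two_pos h; omega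
  have hqd : q ∣ q ^ c * q := Dvd.intro_left _ rfl
  have hqd2 : q ∣ 2 * q ^ c * q := Dvd.intro_left _ rfl
  have h2d : 2 ∣ 2 * q ^ c * q := ⟨q ^ c * q, by ring⟩
  have hcop : p.Coprime q := (Nat.coprime_primes hp hq).2 hpq
  have hcopd : p.Coprime (q ^ c * q) := (hcop.pow_right c).mul_right hcop
  have hcopd2 : p.Coprime (2 * q ^ c * q) :=
    ((hp.coprime_iff_not_dvd.2 hp_two).mul_right (hcop.pow_right c)).mul_right hcop
  obtain ⟨b, hb⟩ := exists_padicInt_eq_bernoulli (p := p) (k := p - 3) (by omega)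
  obtain ⟨y, hy3, hy⟩ := exists_three_mul_eq_teichmullerInv_two hp2
  have hχ := teichmullerInv_neg hp2
  set χ := teichmullerInv p with hχdef
  have hn : p ^ (a + 1) * q ^ (c + 1) = p ^ (a + 1) * (q ^ c * q) := by rw [pow_succ q]
  have hn2 : 2 * p ^ (a + 1) * q ^ (c + 1) = p ^ (a + 1) * (2 * q ^ c * q) := by
    rw [pow_succ q]; ring
  -- The modulus for the weights is d = q^c · q, so m = q^c supplies the factor q^(β-1); the
  -- alternating sum uses twice this modulus to carry the sign.
  have hZ := coe_boxSum_eq_sum_coprimeTriples (p := p) (n := p ^ (a + 1) * (q ^ c * q))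
    (N := p ^ (a + 1) * q ^ (c + 1)) (q := q) (fun _ => 1)
    (fun i => notDvdInd p q (i : ZMod (q ^ c * q)))
    (fun i => notDvdInd p q (i : ZMod (q ^ c * q)))
    (fun i => coprime_iff_of_primes hp hq) (notDvdInd_natCast hqd)
    (fun i => by rw [notDvdInd_natCast hqd]; simp)
  have hA := coe_boxSum_eq_sum_coprimeTriples (p := p) (n := p ^ (a + 1) * (2 * q ^ c * q))
    (N := p * q) (q := q) (fun i => (-1) ^ i)
    (fun i => paritySign p (i : ZMod (2 * q ^ c * q)) * notDvdInd p q (i : ZMod (2 * q ^ c * q)))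
    (fun i => notDvdInd p q (i : ZMod (2 * q ^ c * q)))
    (fun i => by simpa using coprime_iff_of_primes (a := 0) (c := 0) (i := i) hp hq)
    (notDvdInd_natCast hqd2)
    (fun i => by
      rw [paritySign_natCast h2d, notDvdInd_natCast hqd2]
      by_cases hi : q ∣ i
      · simp [hi]
      · rcases Nat.even_or_odd i with h | h
        · simp [hi, h.two_dvd, h.neg_one_pow]
        · simp [hi, h.not_two_dvd_nat, h.neg_one_pow])
  have lZ := dvd_boxSum_prime_pow_sub hp2 (notDvdInd p q) (notDvdInd p q) (notDvdInd p q)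
    (notDvdInd_neg hqd) (notDvdInd_neg hqd) (notDvdInd_neg hqd) a
  have lA := dvd_boxSum_prime_pow_sub hp2
    (fun x : ZMod (2 * q ^ c * q) => paritySign p x * notDvdInd p q x)
    (notDvdInd p q) (notDvdInd p q)
    (fun x => by rw [paritySign_neg h2d, notDvdInd_neg hqd2])
    (notDvdInd_neg hqd2) (notDvdInd_neg hqd2) a
  have rZ := dvd_boxSum_teichmullerInv_sub_recip (p := p) (n := p * (q ^ c * q))
    (s := p * (q ^ c * q)) (d := q ^ c * q) (notDvdInd p q) (notDvdInd p q) (notDvdInd p q)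
  have rA := dvd_boxSum_teichmullerInv_sub_recip (p := p) (n := p * (2 * q ^ c * q))
    (s := p * (2 * q ^ c * q)) (fun x : ZMod (2 * q ^ c * q) => paritySign p x * notDvdInd p q x)
    (notDvdInd p q) (notDvdInd p q)
  have r1 := dvd_boxSum_teichmullerInv_sub_recip (p := p) (n := p) (s := p) (d := 1)
    (fun _ => 1) (fun _ => 1) (fun _ => 1)
  simp only [one_mul] at r1
  have eZ := boxSum_notDvdInd (pow_pos hq.pos c) hcopd χ hχ
  have eA := three_mul_boxSum_paritySign hq2 (hq2.pow (n := c)) hcopd2 χ hχ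
  have e1 := dvd_boxSum_recip_add_bernoulli hp2 b hb
  have hχq := (dvd_iff_toZMod_eq_zero (χ q ^ 3 - recip p q ^ 3)).2 (by
    rw [map_sub, map_pow, map_pow, toZMod_recip, toZMod_teichmullerInv, sub_self])
  rw [← hχdef] at rZ rA r1
  have h2 : (2 : ℤ_[p]) * recip p 2 = 1 := by simpa using mul_recip hp_two
  obtain ⟨g1, g2⟩ := dvd_sub_of_dvd_sub_pow_mul lA lZ rA rZ r1 eA eZ hy3 hy e1
    hχq h2
  have hX : alternatingSum (2 * p ^ (a + 1) * q ^ (c + 1)) (p * q) =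
      ∑ t ∈ coprimeTriples (p ^ (a + 1) * (2 * q ^ c * q)) (p * q),
        (((-1) ^ t.1 : ℤ) : ℚ) / ((t.1 : ℚ) * (t.2.1 : ℚ) * (t.2.2 : ℚ)) := by
    rw [alternatingSum, hn2]
    refine Finset.sum_congr rfl fun t _ => ?_
    push_cast
    rfl
  have hY : harmonicZ (p ^ (a + 1) * q ^ (c + 1)) =
      ∑ t ∈ coprimeTriples (p ^ (a + 1) * (q ^ c * q)) (p ^ (a + 1) * q ^ (c + 1)),
        ((1 : ℤ) : ℚ) / ((t.1 : ℚ) * (t.2.1 : ℚ) * (t.2.2 : ℚ)) := by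
    rw [harmonicZ, ← hn]
    refine Finset.sum_congr rfl fun t _ => ?_
    push_cast
    rfl
  have hA' := hA.trans (congrArg (Rat.cast (K := ℚ_[p])) hX.symm)
  have hZ' := hZ.trans (congrArg (Rat.cast (K := ℚ_[p])) hY.symm)
  have hr2 := coe_recip hp_two
  have hrq := coe_recip hpq'
  have hhalf : ∀ z : ℤ_[p], (z : ℚ_[p]) = ((harmonicZ (p ^ (a + 1) * q ^ (c + 1)) : ℚ) : ℚ_[p]) →
      ((-(recip p 2 * z) : ℤ_[p]) : ℚ_[p]) =
      ((-(1 / 2) * harmonicZ (p ^ (a + 1) * q ^ (c + 1)) : ℚ) : ℚ_[p]) := by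
    intro z hz
    rw [PadicInt.coe_neg, PadicInt.coe_mul, hz, hr2]
    push_cast
    ring
  refine ⟨ratModEq_of_dvd hA' (hhalf _ hZ') g1, ratModEq_of_dvd (hhalf _ hZ') ?_ g2⟩
  rw [Nat.add_sub_cancel, Nat.add_sub_cancel]
  push_cast
  have htwo : ((2 : ℤ_[p]) : ℚ_[p]) = 2 := map_ofNat PadicInt.Coe.ringHom 2
  rw [hrq, hb, htwo]
  ring
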